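/- Let $c>0$ and $0<k<\sqrt c/2$. Let $\phi\in C^\infty(\mathbb R;\mathbb R)$ be the profile of a smooth solitary wave of the Novikov equation with asymptotic value $k$; that is, $u(x,t)=\phi(x-ct)$ solves $$u_t-u_{xxt}=u^2u_{xxx}-4u^2u_x+3uu_xu_{xx},$$ $\phi^2<c$ and $\mu:=\phi-\phi''>0$ on $\mathbb R$, $\phi(x)\to k$ as $x\to\pm\infty$, $\phi'(0)=0$, and $\phi$ is not constant. Put $$a=k(c-k^2)^{3/2},\quad E=\frac{k^2(c-2k^2)}{2c},\quad \omega_0=-9a^{-2/3},\quad \omega_1=9c\,a^{-4/3}(2E+c),$$ let $(1-\partial_x^2)^{-1}$ denote convolution with $\tfrac12e^{-|x|}$, and let $\mathcal L$ be the operator on $L^2(\mathbb R)$ with domain $H^2(\mathbb R)$ given by $$\mathcal L v=-2\big(\mu^{-8/3}v'\big)'+Gv+2\omega_0(1-\partial_x^2)^{-1}v,$$ $$G=\tfrac23\Big(8\mu''\mu^{-11/3}-\tfrac{44}{3}(\mu')^2\mu^{-14/3}+15\mu^{-8/3}\Big)-\tfrac{2\omega_1}{9}\mu^{-4/3}.$$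 For $v\in H^1(\mathbb R)$, $\langle\mathcal Lv,v\rangle$ denotes the quadratic form $$\langle\mathcal Lv,v\rangle=\int_{\mathbb R}2\mu^{-8/3}|v'|^2\,dx+\int_{\mathbb R}G|v|^2\,dx+2\omega_0\int_{\mathbb R}\overline v\,(1-\partial_x^2)^{-1}v\,dx .$$ Let $$\frac{\delta\mathcal F}{\delta m}(\mu)=2(1-\partial_x^2)^{-1}\mu-2k^{4/3}\mu^{-1/3}.$$ Assume that the spectrum of $\mathcal L$ on $L^2(\mathbb R)$ consists of a simple negative eigenvalue, a simple eigenvalue at $0$, and a remaining part that is strictly positive and bounded away from $0$. Then $\frac{\delta\mathcal F}{\delta m}(\mu)$ lies in the range of $\mathcal L$; we write $\mathcal L^{-1}\frac{\delta\mathcal F}{\delta m}(\mu)$ for any of its preimages. If, moreover, $$\Big\langle\mathcal L^{-1}\frac{\delta\mathcal F}{\delta m}(\mu),\frac{\delta\mathcal F}{\delta m}(\mu)\Big\rangle<0$$ (for some preimage; the value does not depend on the choice), then there is a constant $\gamma>0$ such that $$\langle\mathcal Lv,v\rangle\ge\gamma\|v\|_{H^1}^2=\gamma\int_{\mathbb R}\big(|v|^2+|v'|^2\big)\,dx$$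 for all $v\in H^1(\mathbb R)$ (complex-valued, hence in particular real-valued) with $\int_{\mathbb R}\frac{\delta\mathcal F}{\delta m}(\mu)\,v\,dx=0$ and $\int_{\mathbb R}\mu'\,v\,dx=0$. -/

import Mathlib

open MeasureTheory Filter Topology
open scoped ContDiff

noncomputable section

namespace Novikov

/-! ### Smooth solitary waves of the Novikov equation -/

/-- `u t x` solves `u_t - u_{txx} = u² u_{xxx} - 4 u² u_x + 3 u u_x u_{xx}` pointwise. -/
def IsSolution (u : ℝ → ℝ → ℝ) : Prop :=
  ∀ t x : ℝ,
    deriv (fun s => u s x) t - deriv (fun s => iteratedDeriv 2 (u s) x) t =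
      u t x ^ 2 * iteratedDeriv 3 (u t) x - 4 * u t x ^ 2 * deriv (u t) x
        + 3 * u t x * deriv (u t) x * iteratedDeriv 2 (u t) x

/-- The momentum density `μ = φ - φ''`. -/
def momentum (φ : ℝ → ℝ) (x : ℝ) : ℝ := φ x - iteratedDeriv 2 φ x

/-- `φ` is the profile of a smooth solitary wave `u(x,t) = φ(x - ct)` of the Novikov equation with
asymptotic value `k`, satisfying `φ² < c` and `φ - φ'' > 0`, and translated so that
`φ'(0) = 0`. -/
structure IsSmoothSolitaryWave (c k : ℝ) (φ : ℝ → ℝ) : Prop where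
  smooth : ContDiff ℝ ∞ φ
  isSolution : IsSolution (fun t x => φ (x - c * t))
  sq_lt : ∀ x, φ x ^ 2 < c
  momentum_pos : ∀ x, 0 < momentum φ x
  tendsto_atTop : Tendsto φ atTop (𝓝 k)
  tendsto_atBot : Tendsto φ atBot (𝓝 k)
  deriv_zero : deriv φ 0 = 0
  nonconstant : ∃ x, φ x ≠ k

/-! ### Parameters -/

/-- `a = k (c - k²)^{3/2}`. -/
def paramA (c k : ℝ) : ℝ := k * (c - k ^ 2) ^ (3 / 2 : ℝ)

/-- `E = k² (c - 2k²) / (2c)`. -/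
def paramE (c k : ℝ) : ℝ := k ^ 2 * (c - 2 * k ^ 2) / (2 * c)

/-- The Lagrange multiplier `ω₀ = -9 a^{-2/3}`. -/
def omega0 (c k : ℝ) : ℝ := -9 * paramA c k ^ (-2 / 3 : ℝ)

/-- The Lagrange multiplier `ω₁ = 9 c a^{-4/3} (2E + c)`. -/
def omega1 (c k : ℝ) : ℝ := 9 * c * paramA c k ^ (-4 / 3 : ℝ) * (2 * paramE c k + c)

/-! ### The nonlocal operator and the variation of the constraint functional -/

/-- `(1 - ∂ₓ²)⁻¹ f`, the convolution of `f` with the Green's function `e^{-|x|} / 2`. The integral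
converges absolutely at every `x` when `f` is in `L²` and when `f` is measurable and bounded. -/
def helmholtzInv {F : Type*} [NormedAddCommGroup F] [NormedSpace ℝ F] (f : ℝ → F) (x : ℝ) : F :=
  ∫ y, (Real.exp (-|x - y|) / 2) • f y

/-- The first variation `δ𝓕/δm (μ) = 2 (1 - ∂ₓ²)⁻¹ μ - 2 k^{4/3} μ^{-1/3}` of
`𝓕(m) = ∫ (m (1 - ∂ₓ²)⁻¹ m - k²) - 3 k^{4/3} ∫ (m^{2/3} - k^{2/3})`. -/
def constraintGradient (k : ℝ) (φ : ℝ → ℝ) (x : ℝ) : ℝ :=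
  2 * helmholtzInv (momentum φ) x - 2 * k ^ (4 / 3 : ℝ) * momentum φ x ^ (-1 / 3 : ℝ)

/-! ### Function spaces on the line -/

/-- The complex Hilbert space `L²(ℝ)`. -/
abbrev L2 : Type := Lp ℂ 2 (volume : Measure ℝ)

/-- `w` is the weak derivative of `v`. Thus `H¹` is the set of `v` in `L²` with a weak derivative
in `L²`, and `H²` the set of those whose weak derivative is again in `H¹`. -/
def HasWeakDeriv (v w : L2) : Prop :=
  ∀ η : ℝ → ℝ, ContDiff ℝ ∞ η → HasCompactSupport η →
    ∫ x, deriv η x • v x = -∫ x, η x • w x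

/-! ### The Hessian -/

/-- The zeroth-order coefficient of the Hessian,
`(2/3) (8 μ'' μ^{-11/3} - (44/3) (μ')² μ^{-14/3} + 15 μ^{-8/3}) - (2 ω₁ / 9) μ^{-4/3}`. -/
def potential (c k : ℝ) (φ : ℝ → ℝ) (x : ℝ) : ℝ :=
  2 / 3 * (8 * iteratedDeriv 2 (momentum φ) x * momentum φ x ^ (-11 / 3 : ℝ)
      - 44 / 3 * deriv (momentum φ) x ^ 2 * momentum φ x ^ (-14 / 3 : ℝ)
      + 15 * momentum φ x ^ (-8 / 3 : ℝ))
    - 2 * omega1 c k / 9 * momentum φ x ^ (-4 / 3 : ℝ)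

/-- The value at `x` of
`-2 (μ^{-8/3} v')' + potential * v + 2 ω₀ (1 - ∂ₓ²)⁻¹ v`, where `v₁` stands for `v'` and `v₂` for
`v''`, the outer derivative being expanded by the product rule. -/
def hessianExpr (c k : ℝ) (φ : ℝ → ℝ) (v v₁ v₂ : ℝ → ℂ) (x : ℝ) : ℂ :=
  (-2 : ℝ) • (momentum φ x ^ (-8 / 3 : ℝ) • v₂ x
      + deriv (fun y => momentum φ y ^ (-8 / 3 : ℝ)) x • v₁ x)
    + potential c k φ x • v x
    + (2 * omega0 c k) • helmholtzInv v x

theorem integrable_mul_coe (v : L2) {η : ℝ → ℝ} (hη : Continuous η) (hs : HasCompactSupport η) :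
    Integrable (fun x => η x • v x) := by
  have h1 : MemLp η 2 (volume : Measure ℝ) := hη.memLp_of_hasCompactSupport hs
  exact memLp_one_iff_integrable.1 ((Lp.memLp v).smul h1)

theorem integrable_kernel_mul_coe (v : L2) (x : ℝ) :
    Integrable (fun y => (Real.exp (-|x - y|) / 2) • v y) := by
  have h0 : Integrable (fun t : ℝ => Real.exp (-2 * |t|)) := by
    by_contra hn
    have h := integral_comp_abs (f := fun t => Real.exp (-2 * t))
    rw [integral_undef hn, integral_exp_mul_Ioi (by norm_num)] at h
    norm_num at h
  have h1 : MemLp (fun y => Real.exp (-|x - y|) / 2) 2 (volume : Measure ℝ) := by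
    rw [memLp_two_iff_integrable_sq (by fun_prop)]
    refine ((h0.comp_sub_left x).const_mul (1 / 4)).congr (Eventually.of_forall fun y => ?_)
    simp only [div_pow, ← Real.exp_nat_mul]
    push_cast
    ring_nf
  exact memLp_one_iff_integrable.1 ((Lp.memLp v).smul h1)

theorem helmholtzInv_congr {f g : ℝ → ℂ} (h : f =ᵐ[volume] g) (x : ℝ) :
    helmholtzInv f x = helmholtzInv g x := by
  refine integral_congr_ae ?_
  filter_upwards [h] with y hy
  rw [hy]

theorem helmholtzInv_add (v w : L2) (x : ℝ) :
    helmholtzInv (v + w : L2) x = helmholtzInv v x + helmholtzInv w x := by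
  rw [helmholtzInv_congr (Lp.coeFn_add v w)]
  simp only [helmholtzInv, Pi.add_apply, smul_add]
  exact integral_add (integrable_kernel_mul_coe v x) (integrable_kernel_mul_coe w x)

theorem helmholtzInv_smul (z : ℂ) (v : L2) (x : ℝ) :
    helmholtzInv (z • v : L2) x = z • helmholtzInv v x := by
  rw [helmholtzInv_congr (Lp.coeFn_smul z v)]
  simp only [helmholtzInv, Pi.smul_apply]
  rw [← integral_smul]
  refine integral_congr_ae (Eventually.of_forall fun y => ?_)
  exact smul_comm _ _ _

theorem HasWeakDeriv.add {v w v' w' : L2} (h : HasWeakDeriv v v') (h' : HasWeakDeriv w w') :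
    HasWeakDeriv (v + w) (v' + w') := by
  intro η hη hs
  have hd : Continuous (deriv η) := hη.continuous_deriv (by simp)
  have e1 : ∫ x, deriv η x • (v + w : L2) x = ∫ x, (deriv η x • v x + deriv η x • w x) := by
    refine integral_congr_ae ?_
    filter_upwards [Lp.coeFn_add v w] with x hx
    rw [hx, Pi.add_apply, smul_add]
  have e2 : ∫ x, η x • (v' + w' : L2) x = ∫ x, (η x • v' x + η x • w' x) := by
    refine integral_congr_ae ?_
    filter_upwards [Lp.coeFn_add v' w'] with x hx
    rw [hx, Pi.add_apply, smul_add]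
  rw [e1, e2, integral_add (integrable_mul_coe v hd hs.deriv) (integrable_mul_coe w hd hs.deriv),
    integral_add (integrable_mul_coe v' hη.continuous hs) (integrable_mul_coe w' hη.continuous hs),
    h η hη hs, h' η hη hs, neg_add]

theorem HasWeakDeriv.smul (z : ℂ) {v v' : L2} (h : HasWeakDeriv v v') :
    HasWeakDeriv (z • v) (z • v') := by
  intro η hη hs
  have key : ∀ (g : ℝ → ℝ) (u : L2), ∫ x, g x • (z • u : L2) x = z • ∫ x, g x • u x := by
    intro g u
    rw [← integral_smul]
    refine integral_congr_ae ?_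
    filter_upwards [Lp.coeFn_smul z u] with x hx
    rw [hx, Pi.smul_apply]
    exact smul_comm _ _ _
  rw [key, key, h η hη hs, smul_neg]

theorem HasWeakDeriv.zero : HasWeakDeriv 0 0 := by
  intro η _ _
  simp

theorem HasWeakDeriv.eq_zero {w : L2} (h : HasWeakDeriv 0 w) : w = 0 := by
  rw [Lp.eq_zero_iff_ae_eq_zero]
  have hloc : LocallyIntegrable (w : ℝ → ℂ) volume := (Lp.memLp w).locallyIntegrable (by norm_num)
  refine ae_eq_zero_of_integral_contDiff_smul_eq_zero hloc fun η hη hs => ?_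
  have h1 := h η hη hs
  have h2 : ∫ x, deriv η x • (0 : L2) x = 0 := by simp
  rw [h2] at h1
  exact neg_eq_zero.mp h1.symm

/-- The graph of the Hessian `𝓛`: the pairs `(v, f)` of `L²` functions such that `v` is in `H²` and
`f = 𝓛 v` almost everywhere. -/
def hessianGraph (c k : ℝ) (φ : ℝ → ℝ) : Submodule ℂ (L2 × L2) where
  carrier := {p | ∃ v₁ v₂ : L2, HasWeakDeriv p.1 v₁ ∧ HasWeakDeriv v₁ v₂ ∧
    p.2 =ᵐ[volume] hessianExpr c k φ p.1 v₁ v₂}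
  zero_mem' := by
    refine ⟨0, 0, HasWeakDeriv.zero, HasWeakDeriv.zero, Eventually.of_forall fun x => ?_⟩
    simp [hessianExpr, helmholtzInv]
  add_mem' := by
    rintro ⟨v, f⟩ ⟨w, g⟩ ⟨v₁, v₂, h1, h2, h3⟩ ⟨w₁, w₂, h1', h2', h3'⟩
    refine ⟨v₁ + w₁, v₂ + w₂, h1.add h1', h2.add h2', ?_⟩
    simp only [Prod.mk_add_mk] at h3 h3' ⊢
    filter_upwards [h3, h3', Lp.coeFn_add f g, Lp.coeFn_add v w, Lp.coeFn_add v₁ w₁,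
      Lp.coeFn_add v₂ w₂] with x a1 a2 a3 a4 a5 a6
    rw [a3, Pi.add_apply, a1, a2]
    simp only [hessianExpr, a4, a5, a6, Pi.add_apply, helmholtzInv_add, smul_add]
    abel
  smul_mem' := by
    rintro z ⟨v, f⟩ ⟨v₁, v₂, h1, h2, h3⟩
    refine ⟨z • v₁, z • v₂, h1.smul z, h2.smul z, ?_⟩
    simp only [Prod.smul_mk] at h3 ⊢
    filter_upwards [h3, Lp.coeFn_smul z f, Lp.coeFn_smul z v, Lp.coeFn_smul z v₁,
      Lp.coeFn_smul z v₂] with x a1 a3 a4 a5 a6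
    rw [a3, Pi.smul_apply, a1]
    simp only [hessianExpr, a4, a5, a6, Pi.smul_apply, helmholtzInv_smul, Complex.real_smul,
      smul_eq_mul]
    ring

/-- The Hessian `𝓛 = δ²Λ/δm² (μ)` as an unbounded operator on `L²(ℝ)`, with domain the `v` in `H²`
for which `𝓛 v` is in `L²`; for a smooth solitary wave the coefficients are bounded, so that this
is all of `H²`. -/
def hessian (c k : ℝ) (φ : ℝ → ℝ) : L2 →ₗ.[ℂ] L2 := (hessianGraph c k φ).toLinearPMap

theorem hessianGraph_snd_eq_zero (c k : ℝ) (φ : ℝ → ℝ) (p : L2 × L2)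
    (hp : p ∈ hessianGraph c k φ) (h0 : p.1 = 0) : p.2 = 0 := by
  obtain ⟨v, f⟩ := p
  obtain ⟨v₁, v₂, h1, h2, h3⟩ := hp
  simp only at h0 h1 h3 ⊢
  subst h0
  obtain rfl := h1.eq_zero
  obtain rfl := h2.eq_zero
  rw [Lp.eq_zero_iff_ae_eq_zero]
  filter_upwards [h3] with x hx
  rw [hx]
  simp [hessianExpr, helmholtzInv]

theorem graph_hessian (c k : ℝ) (φ : ℝ → ℝ) : (hessian c k φ).graph = hessianGraph c k φ :=
  Submodule.toLinearPMap_graph_eq _ (hessianGraph_snd_eq_zero c k φ)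

/-- The quadratic form `⟨𝓛 v, v⟩` of the Hessian on `H¹`, where `v₁` is the weak derivative of `v`:
the continuous extension from `H²` to `H¹`, with the second-order term integrated by parts. -/
def hessianForm (c k : ℝ) (φ : ℝ → ℝ) (v v₁ : L2) : ℝ :=
  (∫ x, 2 * momentum φ x ^ (-8 / 3 : ℝ) * ‖v₁ x‖ ^ 2) + (∫ x, potential c k φ x * ‖v x‖ ^ 2)
    + 2 * omega0 c k * (∫ x, helmholtzInv v x * (starRingEnd ℂ) (v x)).re

/-! ### Spectral notions for unbounded operators -/

/-- The spectrum of an unbounded operator `A`: the `z` for which `A - z` has no bounded two-sided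
inverse. -/
def unboundedSpectrum (A : L2 →ₗ.[ℂ] L2) : Set ℂ :=
  {z | ¬ ∃ R : L2 →L[ℂ] L2,
    (∀ f : L2, ∃ h : R f ∈ A.domain, A ⟨R f, h⟩ - z • R f = f) ∧
    ∀ v : A.domain, R (A v - z • (v : L2)) = v}

/-- `z` is an eigenvalue of `A` with a one-dimensional eigenspace. -/
def IsSimpleEigenvalue (A : L2 →ₗ.[ℂ] L2) (z : ℂ) : Prop :=
  ∃ χ : A.domain, χ ≠ 0 ∧ A χ = z • (χ : L2) ∧
    ∀ v : A.domain, A v = z • (v : L2) → ∃ b : ℂ, v = b • χ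

/-- The spectrum of `A` consists of a simple negative eigenvalue, a simple eigenvalue at `0`, and a
part which is positive and bounded away from `0`. -/
def SpectralAssumption (A : L2 →ₗ.[ℂ] L2) : Prop :=
  ∃ lam δ : ℝ, lam < 0 ∧ 0 < δ ∧ IsSimpleEigenvalue A (lam : ℂ) ∧ IsSimpleEigenvalue A 0 ∧
    ∀ z ∈ unboundedSpectrum A, z = (lam : ℂ) ∨ z = 0 ∨ ∃ r : ℝ, δ ≤ r ∧ z = (r : ℂ)

/-! ### The Vakhitov-Kolokolov condition and coercivity -/

/-- `w` is a preimage `𝓛⁻¹ (δ𝓕/δm (μ))`. -/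
def IsPreimage (c k : ℝ) (φ : ℝ → ℝ) (w : (hessian c k φ).domain) : Prop :=
  hessian c k φ w =ᵐ[volume] fun x => (constraintGradient k φ x : ℂ)

/-- The condition `⟨𝓛⁻¹ δ𝓕/δm (μ), δ𝓕/δm (μ)⟩ < 0`. Preimages under `𝓛` are unique up to the
kernel, and the pairing, which is real, does not depend on the preimage because `𝓛` is
symmetric. -/
def VakhitovKolokolov (c k : ℝ) (φ : ℝ → ℝ) : Prop :=
  ∃ w : (hessian c k φ).domain, IsPreimage c k φ w ∧
    (∫ x, (w : L2) x * (constraintGradient k φ x : ℂ)).re < 0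

/-- There is `γ > 0` with `⟨𝓛 v, v⟩ ≥ γ ‖v‖²_{H¹}` for every `v` in `H¹` which is `L²`-orthogonal
to `δ𝓕/δm (μ)` and to `μ'`. -/
def IsCoercive (c k : ℝ) (φ : ℝ → ℝ) : Prop :=
  ∃ γ : ℝ, 0 < γ ∧ ∀ v v₁ : L2, HasWeakDeriv v v₁ →
    ∫ x, v x * (constraintGradient k φ x : ℂ) = 0 →
    ∫ x, v x * ((deriv (momentum φ) x : ℝ) : ℂ) = 0 →
    γ * (‖v‖ ^ 2 + ‖v₁‖ ^ 2) ≤ hessianForm c k φ v v₁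

end Novikov

end

/-!
The theorem is a spectral argument for the Hessian `𝓛` of a constrained variational problem, with
the Sobolev theory on the line that it needs built along the way.

*The wave.* Along the wave `(φ² - c) μ' + 3 φ φ' μ = 0`, so `μ (c - φ²)^{3/2}` is constant; letting
`x → ∞` identifies the constant as `a`, and `φ'' = φ - a (c - φ²)^{-3/2}` has the energy integral
`φ'² = φ² - (2a/c) φ (c - φ²)^{-1/2} + 2E` (`IsSmoothSolitaryWave.exists_profile`). With
`q = (c - φ²)^{-1/2}` every coefficient of `𝓛` is a polynomial in the bounded functions `φ`, `φ'`,
`q`. The condition `k < √c / 2` makes the rest state `k` a saddle: `φ'' = (φ - k) M` with `M`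
positive near `±∞`, and `((φ - k) φ')' = φ'² + M (φ - k)²` then gives `φ - k, φ' ∈ L²`
(`memLp_of_second_order`). Hence `μ'` lies in `H²` and the constraint gradient `g` in `L²`. Two
explicit identities follow: `𝓛 μ' = 0` (`Profile.hessian_deriv_momentum_eq_zero`) and `⟪g, μ'⟫ = 0`,
the integrand being an exact derivative.

*The operator.* Integration by parts in `H¹` and the density of `H²` in `H¹` both come from the
density of test functions for the graph norm (`weakDerivGraph_le_topologicalClosure`): a pair
`(v, v')` orthogonal to all test pairs satisfies `(v ± v')' = ±(v ± v')`, and these equations have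
no nonzero solution in `L²`. So `𝓛` is symmetric and is represented by a form that is continuous on
`H¹`.

*The spectrum.* Let `lam` be the negative eigenvalue and `δ` the lower bound of the positive part of
the spectrum. The resolvent of `𝓛` at `lam - 1` is a bounded self-adjoint operator whose spectrum is
the image of that of `𝓛`, together with `0`, and a continuous function of it supported at an
isolated point maps into the corresponding eigenspace
(`cfc_apply_eq_zero_of_support_singleton`). This
yields the Fredholm alternative at `0`, hence a preimage of `g`, and the bound
`⟪v, 𝓛 v⟫ ≥ δ ‖v‖²` on the orthogonal complement of the two eigenvectors.

*Coercivity.* Let `𝓛 w = g` with `⟪w, g⟫ < 0`. A vector `v` of the domain orthogonal to `g` and `μ'`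
splits as `x + s w` with `x` orthogonal to the negative eigenvector, and
`⟪v, 𝓛 v⟫ = ⟪x, 𝓛 x⟫ + |s|² |⟪w, g⟫|` because the cross terms contain `⟪g, v⟫ = 0`
(`HasSpectralGap.exists_le_re_inner_of_orthogonal`). This is coercivity in `L²`; it passes to `H¹`
by density (`Profile.le_form_of_le_on_domain`), and interpolation with the Gårding inequality
(`Profile.exists_garding`) replaces the `L²` norm by the `H¹` norm.
-/

namespace Novikov

/-! ### Isolated spectral points of bounded self-adjoint operators -/

section Bounded

open scoped InnerProductSpace

variable {H : Type*} [NormedAddCommGroup H] [InnerProductSpace ℂ H] [CompleteSpace H]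

theorem continuousOn_ite_eq_of_isolated {S : Set ℝ} {τ ε : ℝ} (hε : 0 < ε)
    (h : ∀ t ∈ S, |t - τ| < ε → t = τ) (b : ℝ) {f : ℝ → ℝ}
    (hf : ∀ t ∈ S, t ≠ τ → ContinuousAt f t) :
    ContinuousOn (fun t => if t = τ then b else f t) S := by
  intro t ht
  by_cases htτ : t = τ
  · subst htτ
    have : (fun s => if s = t then b else f s) =ᶠ[𝓝[S] t] fun _ => b := by
      filter_upwards [self_mem_nhdsWithin, mem_nhdsWithin_of_mem_nhds (Metric.ball_mem_nhds t hε)]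
        with s hs hs'
      rw [if_pos (h s hs (by simpa [Real.dist_eq] using hs'))]
    exact (continuousWithinAt_const.congr_of_eventuallyEq this (by simp))
  · have : (fun s => if s = τ then b else f s) =ᶠ[𝓝 t] f := by
      filter_upwards [isOpen_ne.mem_nhds htτ] with s hs
      rw [if_neg hs]
    exact ((hf t ht htτ).congr this.symm).continuousWithinAt

/-- A continuous function of `T` that is supported at a single point `τ` of the spectrum takes
values in the eigenspace of `τ`; being self-adjoint, it kills the orthogonal complement of that
eigenspace. -/
theorem cfc_apply_eq_zero_of_support_singleton {T : H →L[ℂ] H} (hT : IsSelfAdjoint T) {τ : ℝ}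
    {d : ℝ → ℝ} (hd : ContinuousOn d (spectrum ℝ T)) (hτ : ∀ t ∈ spectrum ℝ T, t ≠ τ → d t = 0)
    {v : H} (hv : ∀ x, T x = (τ : ℂ) • x → ⟪x, v⟫_ℂ = 0) : cfc d T v = 0 := by
  set P := cfc d T with hP
  have hPs : IsSelfAdjoint P := cfc_predicate d T
  have h1 : T * P = τ • P := by
    have h2 : cfc (fun t => t * d t) T = T * P := by
      rw [cfc_mul (fun t => t) d T (by fun_prop) hd, cfc_id' ℝ T]
    rw [← h2, hP, ← cfc_smul τ d T hd]
    refine cfc_congr fun t ht => ?_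
    by_cases htτ : t = τ
    · simp [htτ]
    · simp [hτ t ht htτ]
  have h3 : T (P (P v)) = (τ : ℂ) • P (P v) := by
    have := congrArg (fun S : H →L[ℂ] H => S (P v)) h1
    simpa using this
  have h4 : ⟪P v, P v⟫_ℂ = 0 := by
    rw [← hv _ h3]
    exact (hPs.isSymmetric (P v) v).symm
  exact inner_self_eq_zero.1 h4

/-- If the spectrum of `T` lies in `[0, b]` apart from two points `τ₀` and `τ₁`, then
`T² ≤ b T` on the orthogonal complement of the eigenspaces of `τ₀` and `τ₁`. -/
theorem norm_sq_apply_le_of_spectrum {T : H →L[ℂ] H} (hT : IsSelfAdjoint T) {b τ₀ τ₁ : ℝ}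
    (h0 : b < τ₀) (h1 : τ₀ < τ₁)
    (hσ : ∀ t ∈ spectrum ℝ T, t = τ₀ ∨ t = τ₁ ∨ (0 ≤ t ∧ t ≤ b))
    {v : H} (hv0 : ∀ x, T x = (τ₀ : ℂ) • x → ⟪x, v⟫_ℂ = 0)
    (hv1 : ∀ x, T x = (τ₁ : ℂ) • x → ⟪x, v⟫_ℂ = 0) :
    ‖T v‖ ^ 2 ≤ b * (⟪v, T v⟫_ℂ).re := by
  set f : ℝ → ℝ := fun t => b * t - t * t
  set g : ℝ → ℝ := fun t => if t = τ₀ then 0 else if t = τ₁ then 0 else f t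
  set d0 : ℝ → ℝ := fun t => if t = τ₀ then f τ₀ else 0
  set d1 : ℝ → ℝ := fun t => if t = τ₁ then f τ₁ else 0
  have hfc : Continuous f := by fun_prop
  have hi1 : ∀ t ∈ spectrum ℝ T, |t - τ₁| < τ₁ - τ₀ → t = τ₁ := by
    intro t ht hlt
    rw [abs_lt] at hlt
    rcases hσ t ht with h | h | h
    · linarith
    · exact h
    · linarith [h.2]
  have hi0 : ∀ t ∈ spectrum ℝ T, |t - τ₀| < min (τ₁ - τ₀) (τ₀ - b) → t = τ₀ := by
    intro t ht hlt
    rw [lt_min_iff, abs_lt, abs_lt] at hlt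
    rcases hσ t ht with h | h | h
    · exact h
    · linarith
    · linarith [h.2]
  have hε0 : 0 < min (τ₁ - τ₀) (τ₀ - b) := lt_min (by linarith) (by linarith)
  have hd0 : ContinuousOn d0 (spectrum ℝ T) :=
    continuousOn_ite_eq_of_isolated hε0 hi0 _ fun _ _ _ => continuousAt_const
  have hd1 : ContinuousOn d1 (spectrum ℝ T) :=
    continuousOn_ite_eq_of_isolated (sub_pos.2 h1) hi1 _ fun _ _ _ => continuousAt_const
  have hg : ContinuousOn g (spectrum ℝ T) := by
    have : Set.EqOn g (fun t => f t - (d0 t + d1 t)) (spectrum ℝ T) := by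
      intro t _
      by_cases ht0 : t = τ₀
      · subst ht0; simp [g, d0, d1, h1.ne]
      · by_cases ht1 : t = τ₁
        · subst ht1; simp [g, d0, d1, h1.ne']
        · simp [g, d0, d1, ht0, ht1]
    exact (hfc.continuousOn.sub (hd0.add hd1)).congr this
  have hsum : cfc f T = cfc g T + (cfc d0 T + cfc d1 T) := by
    rw [← cfc_add T d0 d1 hd0 hd1, ← cfc_add T g (fun t => d0 t + d1 t) hg (hd0.add hd1)]
    refine cfc_congr fun t _ => ?_
    by_cases ht0 : t = τ₀
    · subst ht0; simp [g, d0, d1, h1.ne]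
    · by_cases ht1 : t = τ₁
      · subst ht1; simp [g, d0, d1, h1.ne']
      · simp [g, d0, d1, ht0, ht1]
  have e0 : cfc d0 T v = 0 :=
    cfc_apply_eq_zero_of_support_singleton hT hd0 (fun t _ ht => by simp [d0, ht]) hv0
  have e1 : cfc d1 T v = 0 :=
    cfc_apply_eq_zero_of_support_singleton hT hd1 (fun t _ ht => by simp [d1, ht]) hv1
  have hfT : cfc f T = b • T - T * T := by
    rw [cfc_sub (fun t => b * t) (fun t => t * t) T, cfc_mul (fun t => t) (fun t => t) T,
      cfc_const_mul b (fun t => t) T, cfc_id' ℝ T]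
  have hpos : 0 ≤ cfc g T := by
    refine cfc_nonneg fun t ht => ?_
    by_cases ht0 : t = τ₀
    · simp [g, ht0]
    · by_cases ht1 : t = τ₁
      · simp [g, ht1]
      · simp only [g, ht0, ht1, if_false, f]
        obtain ⟨h, h'⟩ := ((hσ t ht).resolve_left ht0).resolve_left ht1
        nlinarith
  have hp := (ContinuousLinearMap.nonneg_iff_isPositive _).1 hpos
  have h5 : 0 ≤ (⟪cfc g T v, v⟫_ℂ).re := hp.re_inner_nonneg_left v
  have h6 : cfc g T v = (b : ℂ) • T v - T (T v) := by
    have := congrArg (fun S : H →L[ℂ] H => S v) (hfT.symm.trans hsum)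
    simp only [add_apply, e0, e1, add_zero] at this
    rw [← this]
    simp
  have h7 : ⟪T (T v), v⟫_ℂ = ⟪T v, T v⟫_ℂ := hT.isSymmetric (T v) v
  have h8 : ⟪T v, v⟫_ℂ = ⟪v, T v⟫_ℂ := hT.isSymmetric v v
  rw [h6, inner_sub_left, inner_smul_left, h7, h8] at h5
  simp only [Complex.conj_ofReal, Complex.sub_re, Complex.re_ofReal_mul] at h5
  have h9 : (⟪T v, T v⟫_ℂ).re = ‖T v‖ ^ 2 := by
    simpa using inner_self_eq_norm_sq (𝕜 := ℂ) (T v)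
  linarith

/-- Solvability of `v + z T v = T g` when `-1 / z` is an isolated point of the spectrum of `T` and
`g` is orthogonal to its eigenspace. -/
theorem exists_add_smul_apply_eq_of_orthogonal {T : H →L[ℂ] H} (hT : IsSelfAdjoint T) {z ε : ℝ}
    (hz : z ≠ 0) (hε : 0 < ε) (hi : ∀ t ∈ spectrum ℝ T, |t - (-1 / z)| < ε → t = -1 / z)
    {g : H} (hg : ∀ x, T x = ((-1 / z : ℝ) : ℂ) • x → ⟪x, g⟫_ℂ = 0) :
    ∃ v, v + (z : ℂ) • T v = T g := by
  set τ : ℝ := -1 / z with hτ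
  have hne : ∀ t, t ≠ τ → 1 + z * t ≠ 0 := by
    intro t ht h0
    apply ht
    rw [hτ, eq_div_iff hz]
    linarith
  set h : ℝ → ℝ := fun t => if t = τ then 0 else t / (1 + z * t)
  set d : ℝ → ℝ := fun t => if t = τ then τ else 0
  have hh : ContinuousOn h (spectrum ℝ T) :=
    continuousOn_ite_eq_of_isolated hε hi _ fun t _ ht =>
      ContinuousAt.div (by fun_prop) (by fun_prop) (hne t ht)
  have hd : ContinuousOn d (spectrum ℝ T) :=
    continuousOn_ite_eq_of_isolated hε hi _ fun _ _ _ => continuousAt_const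
  have key : cfc h T + z • (T * cfc h T) + cfc d T = T := by
    have e1 : T * cfc h T = cfc (fun t => t * h t) T := by
      rw [cfc_mul (fun t => t) h T (by fun_prop) hh, cfc_id' ℝ T]
    have c1 : ContinuousOn (fun t => t * h t) (spectrum ℝ T) := continuousOn_id.mul hh
    rw [e1, ← cfc_smul z (fun t => t * h t) T c1,
      ← cfc_add T h (fun t => z • (t * h t)) hh (c1.const_smul z),
      ← cfc_add T (fun t => h t + z • (t * h t)) d (hh.add (c1.const_smul z)) hd]
    conv_rhs => rw [← cfc_id' ℝ T]
    refine cfc_congr fun t _ => ?_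
    by_cases ht : t = τ
    · simp [h, d, ht]
    · simp only [h, d, ht, if_false, smul_eq_mul]
      have : t / (1 + z * t) + z * (t * (t / (1 + z * t))) + 0 =
          t * ((1 + z * t) / (1 + z * t)) := by ring
      rw [this, div_self (hne t ht), mul_one]
  have e : cfc d T g = 0 :=
    cfc_apply_eq_zero_of_support_singleton hT hd (fun t _ ht => by simp [d, ht]) hg
  refine ⟨cfc h T g, ?_⟩
  have := congrArg (fun S : H →L[ℂ] H => S g) key
  simpa [e] using this

end Bounded

/-! ### Resolvents of unbounded symmetric operators -/

section Unbounded

open scoped InnerProductSpace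

variable {H : Type*} [NormedAddCommGroup H] [InnerProductSpace ℂ H]

/-- `R` is the bounded two-sided inverse of `A - z`. -/
def IsResolvent (A : H →ₗ.[ℂ] H) (z : ℂ) (R : H →L[ℂ] H) : Prop :=
  (∀ f : H, ∃ h : R f ∈ A.domain, A ⟨R f, h⟩ - z • R f = f) ∧
    ∀ v : A.domain, R (A v - z • (v : H)) = v

/-- `A` is symmetric on its domain. -/
def IsSymmetricOp (A : H →ₗ.[ℂ] H) : Prop :=
  ∀ x y : A.domain, ⟪A x, (y : H)⟫_ℂ = ⟪(x : H), A y⟫_ℂ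

variable {A : H →ₗ.[ℂ] H}

theorem IsResolvent.sub_apply {z z' : ℂ} {R S : H →L[ℂ] H} (hR : IsResolvent A z R)
    (hS : IsResolvent A z' S) (f : H) : S f - R f = (z' - z) • R (S f) := by
  obtain ⟨h, e⟩ := hS.1 f
  have e' : A ⟨S f, h⟩ = f + z' • S f := sub_eq_iff_eq_add.1 e
  have := hR.2 ⟨S f, h⟩
  rw [e'] at this
  simp only [map_sub, map_add, map_smul] at this
  rw [sub_smul, sub_eq_iff_eq_add]
  conv_lhs => rw [← this]
  abel

theorem IsResolvent.not_mem_spectrum {z w : ℂ} {R S : H →L[ℂ] H} (hw : w ≠ 0)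
    (hR : IsResolvent A z R) (hS : IsResolvent A (z + 1 / w) S) : w ∉ spectrum ℂ R := by
  have h1 : ∀ f, S f - R f = (1 / w) • R (S f) := fun f => by
    simpa using hR.sub_apply hS f
  have h2 : ∀ f, R f - S f = (-(1 / w)) • S (R f) := fun f => by
    simpa using hS.sub_apply hR f
  rw [spectrum.mem_iff, not_not]
  refine ⟨⟨algebraMap ℂ _ w - R, (1 / w) • (1 + (1 / w) • S), ?_, ?_⟩, rfl⟩
  · ext f
    have := h1 f
    have e : R (S f) = w • (S f - R f) := by rw [this, smul_smul]; field_simp; simp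
    simp [Algebra.algebraMap_eq_smul_one, e, smul_smul, hw, smul_add, smul_sub]
  · ext f
    have := h2 f
    have e : S (R f) = w • (S f - R f) := by
      rw [← neg_sub (R f), this, smul_neg, smul_smul, ← neg_smul]; field_simp; simp
    simp [Algebra.algebraMap_eq_smul_one, e, smul_smul, hw, smul_add, smul_sub]

theorem IsResolvent.isSelfAdjoint [CompleteSpace H] (hA : IsSymmetricOp A) {z : ℝ} {R : H →L[ℂ] H}
    (hR : IsResolvent A z R) : IsSelfAdjoint R := by
  rw [ContinuousLinearMap.isSelfAdjoint_iff_isSymmetric]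
  intro f g
  obtain ⟨hf, ef⟩ := hR.1 f
  obtain ⟨hg, eg⟩ := hR.1 g
  have := hA ⟨R f, hf⟩ ⟨R g, hg⟩
  simp only at this
  change ⟪R f, g⟫_ℂ = ⟪f, R g⟫_ℂ
  conv_lhs => rw [← eg]
  conv_rhs => rw [← ef]
  rw [inner_sub_left, inner_sub_right, this, inner_smul_left, inner_smul_right]
  simp

theorem IsResolvent.eigenvector {z : ℂ} {τ : ℂ} {R : H →L[ℂ] H} (hR : IsResolvent A z R)
    (hτ : τ ≠ 0) {x : H} (hx : R x = τ • x) :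
    ∃ h : x ∈ A.domain, A ⟨x, h⟩ = (z + 1 / τ) • x := by
  obtain ⟨h, e⟩ := hR.1 x
  have hx' : x = τ⁻¹ • R x := by rw [hx, smul_smul, inv_mul_cancel₀ hτ, one_smul]
  have hd : x ∈ A.domain := by rw [hx']; exact A.domain.smul_mem _ h
  refine ⟨hd, ?_⟩
  have e1 : (⟨R x, h⟩ : A.domain) = τ • ⟨x, hd⟩ := Subtype.ext hx
  rw [e1, A.map_smul, hx] at e
  have e2 : τ • A ⟨x, hd⟩ = x + z • τ • x := by
    rw [← sub_eq_iff_eq_add]; exact e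
  have e3 : A ⟨x, hd⟩ = τ⁻¹ • (τ • A ⟨x, hd⟩) := by
    rw [smul_smul, inv_mul_cancel₀ hτ, one_smul]
  rw [e3, e2, smul_add, smul_smul, smul_smul, add_smul, add_comm]
  congr 2 <;> field_simp

/-- The resolvent set contains everything outside `{lam, 0} ∪ [δ, ∞)`. -/
def HasSpectralGap (A : H →ₗ.[ℂ] H) (lam δ : ℝ) : Prop :=
  ∀ z : ℂ, z ≠ lam → z ≠ 0 → (∀ r : ℝ, δ ≤ r → z ≠ r) → ∃ R, IsResolvent A z R

/-- The spectrum of the resolvent at `lam - 1` is contained in the image of that of `A` under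
`s ↦ 1 / (s - (lam - 1))`, together with `0`. As `lam - 1` lies below the spectrum of `A`, it is
nonnegative. -/
theorem HasSpectralGap.spectrum_resolvent {lam δ : ℝ} (hl : lam < 0) (hδ : 0 < δ)
    (hg : HasSpectralGap A lam δ) {R : H →L[ℂ] H}
    (hR : IsResolvent A ((lam - 1 : ℝ) : ℂ) R) :
    ∀ t ∈ spectrum ℝ R, t = 1 / (1 - lam) ∨ t = 1 ∨ (0 ≤ t ∧ t ≤ 1 / (δ + 1 - lam)) := by
  intro t ht
  by_contra! hcon
  obtain ⟨c1, c2, c3⟩ := hcon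
  have ht0 : t ≠ 0 := by
    rintro rfl
    have := c3 le_rfl
    have : 0 < 1 / (δ + 1 - lam) := one_div_pos.2 (by linarith)
    linarith
  have ht' : (t : ℂ) ∈ spectrum ℂ R := by
    simpa using (spectrum.algebraMap_mem_iff (S := ℂ) (r := t) (a := R)).2 ht
  have hz : (((lam - 1 : ℝ) : ℂ) + 1 / (t : ℂ)) = ((lam - 1 + 1 / t : ℝ) : ℂ) := by
    push_cast; ring
  have hex : ∃ S, IsResolvent A (((lam - 1 : ℝ) : ℂ) + 1 / (t : ℂ)) S := by
    refine hg _ ?_ ?_ ?_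
    · rw [hz]
      norm_cast
      intro h
      apply c2
      have : 1 / t = 1 := by linarith
      field_simp at this
      exact this.symm
    · rw [hz]
      norm_cast
      intro h
      apply c1
      have : 1 / t = 1 - lam := by linarith
      rw [← this]; simp
    · intro r hr
      rw [hz]
      norm_cast
      intro h
      have h1 : 1 / t = r + 1 - lam := by linarith
      have h2 : 0 < r + 1 - lam := by linarith
      have h3 : t = 1 / (r + 1 - lam) := by rw [← h1]; simp
      have h4 : 0 ≤ t := by rw [h3]; positivity
      have := c3 h4
      rw [h3] at this
      have := one_div_le_one_div_of_le (by linarith : 0 < δ + 1 - lam)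
        (by linarith : δ + 1 - lam ≤ r + 1 - lam)
      linarith
  obtain ⟨S, hS⟩ := hex
  exact hR.not_mem_spectrum (by exact_mod_cast ht0) hS ht'

theorem HasSpectralGap.exists_resolvent {lam δ : ℝ} (hl : lam < 0) (hδ : 0 < δ)
    (hg : HasSpectralGap A lam δ) : ∃ R, IsResolvent A ((lam - 1 : ℝ) : ℂ) R := by
  refine hg _ ?_ ?_ fun r hr => ?_
  · norm_cast; linarith
  · norm_cast; linarith
  · norm_cast; linarith

variable [CompleteSpace H]

/-- Off the eigenspaces of `lam` and `0` the quadratic form of `A` is bounded below by `δ`. The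
bound is that of `norm_sq_apply_le_of_spectrum` for the resolvent at `lam - 1`. -/
theorem HasSpectralGap.le_re_inner {lam δ : ℝ} (hl : lam < 0) (hδ : 0 < δ) (hA : IsSymmetricOp A)
    (hg : HasSpectralGap A lam δ) (v : A.domain)
    (h1 : ∀ x : A.domain, A x = (lam : ℂ) • (x : H) → ⟪(x : H), (v : H)⟫_ℂ = 0)
    (h0 : ∀ x : A.domain, A x = 0 → ⟪(x : H), (v : H)⟫_ℂ = 0) :
    δ * ‖(v : H)‖ ^ 2 ≤ (⟪(v : H), A v⟫_ℂ).re := by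
  obtain ⟨R, hR⟩ := hg.exists_resolvent hl hδ
  set z : ℝ := lam - 1
  have hb : 0 < δ + 1 - lam := by linarith
  have hl1 : 0 < 1 - lam := by linarith
  set f : H := A v - (z : ℂ) • (v : H) with hf
  have hRf : R f = v := hR.2 v
  -- an eigenvector of the resolvent that is orthogonal to `v` is orthogonal to `(A - z) v`
  have orth : ∀ τ : ℝ, τ ≠ 0 → (∀ x : A.domain, A x = ((z : ℂ) + 1 / (τ : ℂ)) • (x : H) →
      ⟪(x : H), (v : H)⟫_ℂ = 0) → ∀ x, R x = (τ : ℂ) • x → ⟪x, f⟫_ℂ = 0 := by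
    intro τ hτ h x hx
    obtain ⟨hd, e⟩ := hR.eigenvector (by exact_mod_cast hτ) hx
    have h2 := h ⟨x, hd⟩ e
    have h3 := hA ⟨x, hd⟩ v
    simp only at h2 h3
    rw [e, inner_smul_left, h2, mul_zero] at h3
    rw [hf, inner_sub_right, ← h3, inner_smul_right, h2]
    simp
  have key := norm_sq_apply_le_of_spectrum (hR.isSelfAdjoint hA) (b := 1 / (δ + 1 - lam))
    (τ₀ := 1 / (1 - lam)) (τ₁ := 1)
    (one_div_lt_one_div_of_lt hl1 (by linarith)) (by rw [div_lt_one hl1]; linarith)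
    (hg.spectrum_resolvent hl hδ hR) (v := f)
    (orth _ (by positivity) fun x hx => h0 x (by
      rw [hx]
      have : ((z : ℂ) + 1 / ((1 / (1 - lam) : ℝ) : ℂ)) = 0 := by
        have : (1 - lam : ℂ) ≠ 0 := by exact_mod_cast hl1.ne'
        simp only [z]; push_cast; field_simp; ring
      rw [this, zero_smul]))
    (orth _ one_ne_zero fun x hx => h1 x (by
      rw [hx]
      have : ((z : ℂ) + 1 / ((1 : ℝ) : ℂ)) = lam := by simp [z]
      rw [this]))
  rw [hRf, hf, inner_sub_left, inner_smul_left, hA v v] at key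
  have e : (⟪(v : H), (v : H)⟫_ℂ).re = ‖(v : H)‖ ^ 2 := by
    simpa using inner_self_eq_norm_sq (𝕜 := ℂ) (v : H)
  simp only [Complex.conj_ofReal, Complex.sub_re, Complex.re_ofReal_mul, e] at key
  rw [one_div, ← div_eq_inv_mul, le_div_iff₀ hb] at key
  simp only [z] at key
  nlinarith

/-- The Fredholm alternative at the isolated eigenvalue `0`. -/
theorem HasSpectralGap.exists_apply_eq {lam δ : ℝ} (hl : lam < 0) (hδ : 0 < δ)
    (hA : IsSymmetricOp A) (hg : HasSpectralGap A lam δ) (g : H)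
    (h0 : ∀ x : A.domain, A x = 0 → ⟪(x : H), g⟫_ℂ = 0) : ∃ v : A.domain, A v = g := by
  obtain ⟨R, hR⟩ := hg.exists_resolvent hl hδ
  have hσ := hg.spectrum_resolvent hl hδ hR
  set z : ℝ := lam - 1 with hz
  have hb : 0 < δ + 1 - lam := by linarith
  have hl1 : 0 < 1 - lam := by linarith
  have hτ : -1 / z = 1 / (1 - lam) := by
    rw [hz, neg_div, ← div_neg]; congr 1; ring
  have hlt := one_div_lt_one_div_of_lt hl1 (by linarith : 1 - lam < δ + 1 - lam)
  have hlt1 : 1 / (1 - lam) < 1 := by rw [div_lt_one hl1]; linarith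
  obtain ⟨v, hv⟩ := exists_add_smul_apply_eq_of_orthogonal (hR.isSelfAdjoint hA) (z := z)
    (ε := min (1 - 1 / (1 - lam)) (1 / (1 - lam) - 1 / (δ + 1 - lam)))
    (by rw [hz]; linarith) (lt_min (by linarith) (by linarith))
    (by
      intro t ht h
      rw [hτ] at h ⊢
      rw [lt_min_iff, abs_lt, abs_lt] at h
      rcases hσ t ht with h' | h' | h'
      · exact h'
      · linarith
      · linarith [h'.2]) (g := g)
    (by
      intro x hx
      rw [hτ] at hx
      obtain ⟨hd, e⟩ := hR.eigenvector (by
        have : (1 / (1 - lam) : ℝ) ≠ 0 := by positivity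
        exact_mod_cast this) hx
      refine h0 ⟨x, hd⟩ ?_
      rw [e]
      have : ((z : ℂ) + 1 / ((1 / (1 - lam) : ℝ) : ℂ)) = 0 := by
        have : (1 - lam : ℂ) ≠ 0 := by exact_mod_cast hl1.ne'
        simp only [z]; push_cast; field_simp; ring
      rw [this, zero_smul])
  have hv' : v = R (g - (z : ℂ) • v) := by
    rw [map_sub, map_smul, ← hv]; abel
  obtain ⟨h, e⟩ := hR.1 (g - (z : ℂ) • v)
  refine ⟨⟨R (g - (z : ℂ) • v), h⟩, ?_⟩
  refine (sub_eq_iff_eq_add.1 e).trans ?_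
  rw [← hv', sub_add_cancel]

/-- The Vakhitov-Kolokolov argument. If `A w = g` and `⟪w, A w⟫ < 0`, then every `v` in the domain
that is orthogonal to `g` and to the kernel splits as `v = x + s w` with `x` orthogonal to the
negative eigenvector and the kernel, and
`⟪v, A v⟫ = ⟪x, A x⟫ + |s|² |⟪w, A w⟫|`. -/
theorem HasSpectralGap.exists_le_re_inner_of_orthogonal {lam δ : ℝ} (hl : lam < 0) (hδ : 0 < δ)
    (hA : IsSymmetricOp A) (hg : HasSpectralGap A lam δ) {χ χ₀ : A.domain}
    (hχu : ∀ v : A.domain, A v = (lam : ℂ) • (v : H) → ∃ b : ℂ, v = b • χ)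
    (hχ₀ : A χ₀ = 0) (hχ₀n : χ₀ ≠ 0)
    (hχ₀u : ∀ v : A.domain, A v = 0 → ∃ b : ℂ, v = b • χ₀)
    {w : A.domain} (hw : (⟪(w : H), A w⟫_ℂ).re < 0) :
    ∃ α : ℝ, 0 < α ∧ ∀ v : A.domain, ⟪A w, (v : H)⟫_ℂ = 0 → ⟪(χ₀ : H), (v : H)⟫_ℂ = 0 →
      α * ‖(v : H)‖ ^ 2 ≤ (⟪(v : H), A v⟫_ℂ).re := by
  have hχ₀n' : ⟪(χ₀ : H), (χ₀ : H)⟫_ℂ ≠ 0 := by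
    rw [inner_self_ne_zero]
    exact fun h => hχ₀n (Subtype.ext h)
  have low : ∀ v : A.domain, ⟪(χ : H), (v : H)⟫_ℂ = 0 → ⟪(χ₀ : H), (v : H)⟫_ℂ = 0 →
      δ * ‖(v : H)‖ ^ 2 ≤ (⟪(v : H), A v⟫_ℂ).re := by
    intro v hv hv0
    refine hg.le_re_inner hl hδ hA v (fun x hx => ?_) fun x hx => ?_
    · obtain ⟨b, rfl⟩ := hχu x hx
      rw [A.domain.coe_smul, inner_smul_left, hv, mul_zero]
    · obtain ⟨b, rfl⟩ := hχ₀u x hx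
      rw [A.domain.coe_smul, inner_smul_left, hv0, mul_zero]
  -- replace `w` by its component orthogonal to the kernel
  obtain ⟨w, hw0, hAw, hw⟩ : ∃ w' : A.domain, ⟪(χ₀ : H), (w' : H)⟫_ℂ = 0 ∧ A w = A w' ∧
      (⟪(w' : H), A w'⟫_ℂ).re < 0 := by
    set b := ⟪(χ₀ : H), (w : H)⟫_ℂ / ⟪(χ₀ : H), (χ₀ : H)⟫_ℂ
    have e : A (w - b • χ₀) = A w := by rw [A.map_sub, A.map_smul, hχ₀, smul_zero, sub_zero]
    refine ⟨w - b • χ₀, ?_, e.symm, ?_⟩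
    · rw [A.domain.coe_sub, A.domain.coe_smul, inner_sub_right, inner_smul_right,
        div_mul_cancel₀ _ hχ₀n', sub_self]
    · rw [e, A.domain.coe_sub, A.domain.coe_smul, inner_sub_left, inner_smul_left, ← hA χ₀ w, hχ₀,
        inner_zero_left, mul_zero, sub_zero]
      exact hw
  rw [hAw]
  set κ : ℝ := -(⟪(w : H), A w⟫_ℂ).re with hκ
  have hκ0 : 0 < κ := by linarith
  have ha : ⟪(χ : H), (w : H)⟫_ℂ ≠ 0 := by
    intro h
    have := low w h hw0
    have : 0 ≤ δ * ‖(w : H)‖ ^ 2 := by positivity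
    linarith
  refine ⟨min (δ / 2) (κ / (2 * (‖(w : H)‖ ^ 2 + 1))), by positivity, fun v hv hv0 => ?_⟩
  set α := min (δ / 2) (κ / (2 * (‖(w : H)‖ ^ 2 + 1)))
  set s := ⟪(χ : H), (v : H)⟫_ℂ / ⟪(χ : H), (w : H)⟫_ℂ with hs
  set x : A.domain := v - s • w with hx
  have hx1 : ⟪(χ : H), (x : H)⟫_ℂ = 0 := by
    rw [hx, A.domain.coe_sub, A.domain.coe_smul, inner_sub_right, inner_smul_right, hs,
      div_mul_cancel₀ _ ha, sub_self]
  have hx0 : ⟪(χ₀ : H), (x : H)⟫_ℂ = 0 := by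
    rw [hx, A.domain.coe_sub, A.domain.coe_smul, inner_sub_right, inner_smul_right, hv0, hw0,
      mul_zero, sub_self]
  have hlow := low x hx1 hx0
  have hv' : ⟪(v : H), A w⟫_ℂ = 0 := by rw [← inner_conj_symm, hv, map_zero]
  have hwv : ⟪(w : H), A v⟫_ℂ = 0 := by rw [← hA, hv]
  have hexp : (⟪(x : H), A x⟫_ℂ).re = (⟪(v : H), A v⟫_ℂ).re - ‖s‖ ^ 2 * κ := by
    rw [hx, A.domain.coe_sub, A.domain.coe_smul, A.map_sub, A.map_smul, inner_sub_left,
      inner_sub_right, inner_sub_right, inner_smul_left, inner_smul_right, inner_smul_left,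
      inner_smul_right, hv', hwv, ← mul_assoc, mul_comm (starRingEnd ℂ s) s, Complex.mul_conj,
      Complex.normSq_eq_norm_sq]
    simp only [mul_zero, sub_zero, zero_sub, sub_neg_eq_add, Complex.add_re,
      Complex.re_ofReal_mul, hκ]
    ring
  have hnorm : ‖(v : H)‖ ^ 2 ≤ 2 * ‖(x : H)‖ ^ 2 + 2 * (‖s‖ ^ 2 * ‖(w : H)‖ ^ 2) := by
    have e : (v : H) = (x : H) + s • (w : H) := by
      rw [hx, A.domain.coe_sub, A.domain.coe_smul]; abel
    have h1 : ‖(v : H)‖ ≤ ‖(x : H)‖ + ‖s‖ * ‖(w : H)‖ := by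
      rw [e, ← norm_smul]; exact norm_add_le _ _
    have h2 : ‖(v : H)‖ ^ 2 ≤ (‖(x : H)‖ + ‖s‖ * ‖(w : H)‖) ^ 2 := by gcongr
    nlinarith [sq_nonneg (‖(x : H)‖ - ‖s‖ * ‖(w : H)‖)]
  have hα0 : 0 < α := by positivity
  have hα1 : 2 * α ≤ δ := by
    have : α ≤ δ / 2 := min_le_left _ _
    linarith
  have hα2 : 2 * α * ‖(w : H)‖ ^ 2 ≤ κ := by
    have : α ≤ κ / (2 * (‖(w : H)‖ ^ 2 + 1)) := min_le_right _ _
    rw [le_div_iff₀ (by positivity)] at this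
    nlinarith
  calc α * ‖(v : H)‖ ^ 2
      ≤ α * (2 * ‖(x : H)‖ ^ 2 + 2 * (‖s‖ ^ 2 * ‖(w : H)‖ ^ 2)) := by gcongr
    _ = 2 * α * ‖(x : H)‖ ^ 2 + ‖s‖ ^ 2 * (2 * α * ‖(w : H)‖ ^ 2) := by ring
    _ ≤ δ * ‖(x : H)‖ ^ 2 + ‖s‖ ^ 2 * κ := by gcongr
    _ ≤ (⟪(v : H), A v⟫_ℂ).re := by linarith

end Unbounded

/-! ### Weak derivatives on the line -/

/-- A real square-integrable function as an element of the complex space `L²(ℝ)`. -/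
noncomputable def ofRealLp (f : ℝ → ℝ) (hf : MemLp f 2 (volume : Measure ℝ)) : L2 :=
  (hf.ofReal (K := ℂ)).toLp _

theorem coeFn_ofRealLp {f : ℝ → ℝ} (hf : MemLp f 2 (volume : Measure ℝ)) :
    ofRealLp f hf =ᵐ[volume] fun x => (f x : ℂ) :=
  MemLp.coeFn_toLp _

theorem inner_ofRealLp {f : ℝ → ℝ} (hf : MemLp f 2 (volume : Measure ℝ)) (v : L2) :
    inner ℂ (ofRealLp f hf) v = ∫ x, f x • v x := by
  rw [L2.inner_def]
  refine integral_congr_ae ?_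
  filter_upwards [coeFn_ofRealLp hf] with x hx
  rw [hx]
  simp [mul_comm]

theorem memLp_test {η : ℝ → ℝ} (hη : ContDiff ℝ ∞ η) (hs : HasCompactSupport η) :
    MemLp η 2 (volume : Measure ℝ) :=
  hη.continuous.memLp_of_hasCompactSupport hs

theorem contDiff_deriv_test {η : ℝ → ℝ} (hη : ContDiff ℝ ∞ η) : ContDiff ℝ ∞ (deriv η) :=
  (contDiff_infty_iff_deriv.1 hη).2

theorem hasWeakDeriv_iff_inner {v w : L2} : HasWeakDeriv v w ↔
    ∀ (η : ℝ → ℝ) (hη : ContDiff ℝ ∞ η) (hs : HasCompactSupport η),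
      inner ℂ (ofRealLp (deriv η) (memLp_test (contDiff_deriv_test hη) hs.deriv)) v =
        -inner ℂ (ofRealLp η (memLp_test hη hs)) w := by
  simp only [inner_ofRealLp]
  rfl

theorem HasWeakDeriv.neg {v w : L2} (h : HasWeakDeriv v w) : HasWeakDeriv (-v) (-w) := by
  simpa using h.smul (-1)

theorem HasWeakDeriv.sub {v w v' w' : L2} (h : HasWeakDeriv v v') (h' : HasWeakDeriv w w') :
    HasWeakDeriv (v - w) (v' - w') := by
  simpa [sub_eq_add_neg] using h.add h'.neg

theorem HasWeakDeriv.unique {v w w' : L2} (h : HasWeakDeriv v w) (h' : HasWeakDeriv v w') :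
    w = w' := by
  have := h.sub h'
  rw [sub_self] at this
  exact sub_eq_zero.1 this.eq_zero

theorem hasWeakDeriv_ofRealLp {f f' : ℝ → ℝ} (hd : ∀ x, HasDerivAt f (f' x) x)
    (hf : MemLp f 2 (volume : Measure ℝ)) (hf' : MemLp f' 2 (volume : Measure ℝ)) :
    HasWeakDeriv (ofRealLp f hf) (ofRealLp f' hf') := by
  intro η hη hs
  have hdη : ContDiff ℝ ∞ (deriv η) := contDiff_deriv_test hη
  have i1 := integrable_mul_coe (ofRealLp f hf) hdη.continuous hs.deriv
  have i2 := integrable_mul_coe (ofRealLp f' hf') hη.continuous hs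
  have i3 := integrable_mul_coe (ofRealLp f hf) hη.continuous hs
  have c : ∀ (g ζ : ℝ → ℝ) (hg : MemLp g 2 (volume : Measure ℝ)),
      (fun x => ζ x • ofRealLp g hg x) =ᵐ[volume] fun x => ζ x • (g x : ℂ) := by
    intro g ζ hg
    filter_upwards [coeFn_ofRealLp hg] with x hx
    rw [hx]
  have key := integral_bilinear_hasDerivAt_right_eq_neg_left_of_integrable
    (L := ContinuousLinearMap.lsmul ℝ ℝ) (u := η) (v := fun x => (f x : ℂ)) (u' := deriv η)
    (v' := fun x => (f' x : ℂ))
    (fun x _ => (hη.differentiable (by simp)).differentiableAt.hasDerivAt)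
    (fun x _ => (hd x).ofReal_comp)
    (i2.congr (c _ _ _)) (i1.congr (c _ _ _)) (i3.congr (c _ _ _))
  simp only [ContinuousLinearMap.lsmul_apply] at key
  rw [integral_congr_ae (c _ _ _), integral_congr_ae (c _ _ _), key, neg_neg]

theorem contDiff_infty_of_hasDerivAt {F f : ℝ → ℝ} (h : ∀ x, HasDerivAt F (f x) x)
    (hf : ContDiff ℝ ∞ f) : ContDiff ℝ ∞ F := by
  rw [contDiff_infty_iff_deriv]
  refine ⟨fun x => (h x).differentiableAt, ?_⟩
  rwa [show deriv F = f from funext fun x => (h x).deriv]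

/-- A test function of mean zero is the derivative of a test function. -/
theorem exists_test_deriv_eq {ζ : ℝ → ℝ} (hζ : ContDiff ℝ ∞ ζ) (hs : HasCompactSupport ζ)
    (h0 : ∫ x, ζ x = 0) :
    ∃ Z : ℝ → ℝ, ContDiff ℝ ∞ Z ∧ HasCompactSupport Z ∧ deriv Z = ζ := by
  obtain ⟨r, hr0, hr⟩ := hs.isCompact.isBounded.subset_ball_lt 0 (0 : ℝ)
  have hz : ∀ x, r ≤ |x| → ζ x = 0 := by
    intro x hx
    by_contra hne
    have := hr (subset_tsupport ζ hne)
    rw [Metric.mem_ball, Real.dist_eq, sub_zero] at this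
    linarith
  have hd : ∀ x, HasDerivAt (fun x => ∫ t in (-r)..x, ζ t) (ζ x) x := fun x =>
    (hζ.continuous.integral_hasStrictDerivAt (-r) x).hasDerivAt
  refine ⟨fun x => ∫ t in (-r)..x, ζ t, contDiff_infty_of_hasDerivAt hd hζ, ?_,
    funext fun x => (hd x).deriv⟩
  refine HasCompactSupport.of_support_subset_isCompact (isCompact_Icc (a := -r) (b := r)) ?_
  intro x hx
  by_contra hn
  apply hx
  rw [Set.mem_Icc, not_and_or, not_le, not_le] at hn
  rcases hn with hn | hn
  · refine intervalIntegral.integral_zero_ae (Eventually.of_forall fun t ht => hz t ?_)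
    rw [Set.uIoc_of_ge hn.le] at ht
    rw [abs_of_nonpos (by linarith [ht.2])]
    linarith [ht.2]
  · rw [← h0]
    refine intervalIntegral.integral_eq_integral_of_support_subset fun t ht => ?_
    by_contra hn'
    apply ht
    apply hz
    rw [Set.mem_Ioc, not_and_or, not_lt, not_le] at hn'
    rcases hn' with h | h
    · rw [abs_of_nonpos (by linarith)]; linarith
    · exact (by linarith : r ≤ t).trans (le_abs_self t)

/-- The lemma of du Bois-Reymond: a function with vanishing weak derivative is constant. -/
theorem ae_eq_const_of_integral_deriv_smul_eq_zero {U : ℝ → ℂ} (hU : LocallyIntegrable U volume)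
    (h : ∀ η : ℝ → ℝ, ContDiff ℝ ∞ η → HasCompactSupport η → ∫ x, deriv η x • U x = 0) :
    ∃ C : ℂ, U =ᵐ[volume] fun _ => C := by
  let β : ContDiffBump (0 : ℝ) := default
  set ψ : ℝ → ℝ := β.normed volume
  have hψ : ContDiff ℝ ∞ ψ := β.contDiff_normed
  have hψs : HasCompactSupport ψ := β.hasCompactSupport_normed
  have hψ1 : ∫ x, ψ x = 1 := β.integral_normed
  have int : ∀ (η : ℝ → ℝ), ContDiff ℝ ∞ η → HasCompactSupport η →
      Integrable (fun x => η x • U x) := fun η hη hs =>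
    hU.integrable_smul_left_of_hasCompactSupport hη.continuous hs
  set C := ∫ x, ψ x • U x
  refine ⟨C, ae_eq_of_integral_contDiff_smul_eq hU (locallyIntegrable_const C)
    fun η hη hs => ?_⟩
  have hηi : Integrable η := hη.continuous.integrable_of_hasCompactSupport hs
  have hψi : Integrable ψ := hψ.continuous.integrable_of_hasCompactSupport hψs
  set m := ∫ x, η x with hm
  have hs' : HasCompactSupport (fun x => m * ψ x) := hψs.mul_left
  obtain ⟨Z, hZ, hZs, hdZ⟩ := exists_test_deriv_eq (ζ := fun x => η x - m * ψ x)
    (hη.sub (contDiff_const.mul hψ)) (hs.sub hs')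
    (by rw [integral_sub hηi (hψi.const_mul m), integral_const_mul, hψ1, mul_one, sub_self])
  have := h Z hZ hZs
  rw [hdZ] at this
  simp only [sub_smul, mul_smul] at this
  rw [integral_sub (int η hη hs)
    (show Integrable (fun x => m • ψ x • U x) from (int ψ hψ hψs).smul m),
    integral_smul, sub_eq_zero] at this
  rw [this, integral_smul_const]

theorem not_integrable_exp_mul {s : ℝ} (hs : s ≠ 0) :
    ¬ Integrable (fun x : ℝ => Real.exp (s * x)) := by
  intro h
  have h1 : ∫ x : ℝ, Real.exp (s * (x + 1)) = ∫ x : ℝ, Real.exp (s * x) :=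
    integral_add_right_eq_self (fun x => Real.exp (s * x)) 1
  have h2 : ∫ x : ℝ, Real.exp (s * (x + 1)) = Real.exp s * ∫ x : ℝ, Real.exp (s * x) := by
    rw [← integral_const_mul]
    refine integral_congr_ae (Eventually.of_forall fun x => ?_)
    simp only [mul_add, mul_one, Real.exp_add]
    ring
  have h3 : 0 < ∫ x : ℝ, Real.exp (s * x) := integral_exp_pos h
  have h4 : Real.exp s = 1 := by
    have := h2.symm.trans h1
    nlinarith
  exact hs (Real.exp_eq_one_iff s |>.1 h4)

/-- The equation `u' = s u` has no nonzero square-integrable solution. -/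
theorem HasWeakDeriv.eq_zero_of_eigen {s : ℝ} (hs : s ≠ 0) {u : L2}
    (h : HasWeakDeriv u ((s : ℂ) • u)) : u = 0 := by
  have hloc : LocallyIntegrable (u : ℝ → ℂ) volume := (Lp.memLp u).locallyIntegrable (by norm_num)
  have hU : LocallyIntegrable (fun x => Real.exp (-s * x) • u x) volume := by
    have := hloc.locallyIntegrableOn Set.univ
    rw [← locallyIntegrableOn_univ]
    exact this.continuousOn_smul isOpen_univ.isLocallyClosed (by fun_prop)
  obtain ⟨C, hC⟩ := ae_eq_const_of_integral_deriv_smul_eq_zero hU (by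
    intro η hη hsη
    have hd : ∀ x, HasDerivAt (fun x => η x * Real.exp (-s * x))
        (deriv η x * Real.exp (-s * x) + η x * (-s * Real.exp (-s * x))) x := by
      intro x
      have h1 : HasDerivAt η (deriv η x) x :=
        (hη.differentiable (by simp)).differentiableAt.hasDerivAt
      have h2 : HasDerivAt (fun x => Real.exp (-s * x)) (-s * Real.exp (-s * x)) x := by
        have := ((hasDerivAt_id x).const_mul (-s)).exp
        simpa [mul_comm] using this
      exact h1.mul h2
    have hη' : ContDiff ℝ ∞ (fun x => η x * Real.exp (-s * x)) := hη.mul (by fun_prop)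
    have hs' : HasCompactSupport (fun x => η x * Real.exp (-s * x)) := hsη.mul_right
    have hdη : Continuous (deriv η) := hη.continuous_deriv (by simp)
    have key := h _ hη' hs'
    have e1 : ∫ x, deriv (fun x => η x * Real.exp (-s * x)) x • u x =
        (∫ x, deriv η x • Real.exp (-s * x) • u x)
          - s • ∫ x, (η x * Real.exp (-s * x)) • u x := by
      rw [← integral_smul, ← integral_sub]
      · refine integral_congr_ae (Eventually.of_forall fun x => ?_)
        simp only [(hd x).deriv, Complex.real_smul]
        push_cast
        ring
      · have := integrable_mul_coe u (η := fun x => deriv η x * Real.exp (-s * x))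
          (by fun_prop) hsη.deriv.mul_right
        simpa only [mul_smul] using this
      · exact (integrable_mul_coe u hη'.continuous hs').smul s
    have e2 : ∫ x, (η x * Real.exp (-s * x)) • ((s : ℂ) • u : L2) x =
        s • ∫ x, (η x * Real.exp (-s * x)) • u x := by
      rw [← integral_smul]
      refine integral_congr_ae ?_
      filter_upwards [Lp.coeFn_smul (s : ℂ) u] with x hx
      rw [hx, Pi.smul_apply]
      simp only [Complex.real_smul, smul_eq_mul]
      ring
    rw [e1, e2] at key
    exact sub_left_injective.eq_iff.1 (key.trans (by simp)))
  by_cases hC0 : C = 0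
  · rw [Lp.eq_zero_iff_ae_eq_zero]
    filter_upwards [hC] with x hx
    rw [hC0] at hx
    exact (smul_eq_zero.1 hx).resolve_left (Real.exp_pos _).ne'
  · exfalso
    have h1 : Integrable (fun x => ‖u x‖ ^ 2) := (Lp.memLp u).integrable_norm_pow (by norm_num)
    refine not_integrable_exp_mul (s := 2 * s) (by simpa using hs) ?_
    have h2 := h1.const_mul (1 / ‖C‖ ^ 2)
    refine h2.congr ?_
    filter_upwards [hC] with x hx
    have e : Real.exp (-s * x) * ‖u x‖ = ‖C‖ := by
      rw [← hx, norm_smul, Real.norm_of_nonneg (Real.exp_pos _).le]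
    have hC1 : 0 < ‖C‖ := norm_pos_iff.2 hC0
    have e2 : ‖u x‖ = Real.exp (s * x) * ‖C‖ := by
      rw [← e, ← mul_assoc, ← Real.exp_add]; simp
    have e3 : Real.exp (2 * s * x) = Real.exp (s * x) ^ 2 := by
      rw [← Real.exp_nat_mul]; congr 1; push_cast; ring
    rw [e2, e3]
    field_simp

/-! ### Density of test functions in `H¹` -/

/-- The graph of the weak derivative, as a subspace of the Hilbert space `L² ⊕ L²`. -/
def weakDerivGraph : Submodule ℂ (WithLp 2 (L2 × L2)) where
  carrier := {p | HasWeakDeriv p.fst p.snd}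
  zero_mem' := HasWeakDeriv.zero
  add_mem' h h' := h.add h'
  smul_mem' z _ h := h.smul z

/-- The pairs `(η, η')` with `η` a real test function. -/
def testPairs : Set (WithLp 2 (L2 × L2)) :=
  {p | ∃ (η : ℝ → ℝ) (hη : ContDiff ℝ ∞ η) (hs : HasCompactSupport η),
    p = WithLp.toLp 2 (ofRealLp η (memLp_test hη hs),
      ofRealLp (deriv η) (memLp_test (contDiff_deriv_test hη) hs.deriv))}

theorem hasDerivAt_test {η : ℝ → ℝ} (hη : ContDiff ℝ ∞ η) (x : ℝ) :
    HasDerivAt η (deriv η x) x :=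
  (hη.differentiable (by simp)).differentiableAt.hasDerivAt

theorem hasWeakDeriv_test {η : ℝ → ℝ} (hη : ContDiff ℝ ∞ η) (hs : HasCompactSupport η) :
    HasWeakDeriv (ofRealLp η (memLp_test hη hs))
      (ofRealLp (deriv η) (memLp_test (contDiff_deriv_test hη) hs.deriv)) :=
  hasWeakDeriv_ofRealLp (hasDerivAt_test hη) _ _

theorem isClosed_weakDerivGraph : IsClosed (weakDerivGraph : Set (WithLp 2 (L2 × L2))) := by
  have : (weakDerivGraph : Set (WithLp 2 (L2 × L2))) =
      ⋂ (η : ℝ → ℝ) (hη : ContDiff ℝ ∞ η) (hs : HasCompactSupport η),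
        {p | inner ℂ (ofRealLp (deriv η) (memLp_test (contDiff_deriv_test hη) hs.deriv)) p.fst =
        -inner ℂ (ofRealLp η (memLp_test hη hs)) p.snd} := by
    ext p
    simp only [Set.mem_iInter, Set.mem_ofPred_eq]
    exact hasWeakDeriv_iff_inner
  rw [this]
  refine isClosed_iInter fun η => isClosed_iInter fun hη => isClosed_iInter fun hs => ?_
  refine isClosed_eq ?_ ?_
  · exact continuous_const.inner (WithLp.prod_continuous_ofLp 2 L2 L2).fst
  · exact (continuous_const.inner (WithLp.prod_continuous_ofLp 2 L2 L2).snd).neg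

/-- Test functions are dense in `H¹` for the graph norm: a pair `(v, v')` orthogonal to all test
pairs satisfies `v'' = v` weakly, so that `(v ± v')' = ±(v ± v')` and `v = 0`. -/
theorem weakDerivGraph_le_topologicalClosure :
    weakDerivGraph ≤ (Submodule.span ℂ testPairs).topologicalClosure := by
  set S := (Submodule.span ℂ testPairs).topologicalClosure with hS
  have hSG : S ≤ weakDerivGraph := by
    refine Submodule.topologicalClosure_minimal _ (Submodule.span_le.2 ?_) isClosed_weakDerivGraph
    rintro _ ⟨η, hη, hs, rfl⟩
    exact hasWeakDeriv_test hη hs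
  have : CompleteSpace S := (Submodule.isClosed_topologicalClosure _).completeSpace_coe
  intro p hp
  obtain ⟨y, hy, z, hz, rfl⟩ := S.exists_add_mem_mem_orthogonal p
  have hzG : z ∈ weakDerivGraph := by
    have := weakDerivGraph.sub_mem hp (hSG hy)
    simpa using this
  suffices z = 0 by rw [this, add_zero]; exact hy
  have h1 : HasWeakDeriv z.fst z.snd := hzG
  have h2 : HasWeakDeriv z.snd z.fst := by
    rw [hasWeakDeriv_iff_inner]
    intro η hη hs
    have hmem : WithLp.toLp 2 (ofRealLp η (memLp_test hη hs),
        ofRealLp (deriv η) (memLp_test (contDiff_deriv_test hη) hs.deriv)) ∈ S :=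
      Submodule.le_topologicalClosure _ (Submodule.subset_span ⟨η, hη, hs, rfl⟩)
    have := hz _ hmem
    rw [WithLp.prod_inner_apply] at this
    rw [eq_neg_iff_add_eq_zero, add_comm]
    exact this
  have h3 : z.fst + z.snd = 0 := by
    refine HasWeakDeriv.eq_zero_of_eigen (s := 1) one_ne_zero ?_
    simpa [add_comm] using h1.add h2
  have h4 : z.fst - z.snd = 0 := by
    refine HasWeakDeriv.eq_zero_of_eigen (s := -1) (by norm_num) ?_
    simpa using h1.sub h2
  have h5 : z.fst = z.snd := sub_eq_zero.1 h4
  have h6 : z.snd = 0 := by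
    rw [h5, ← two_smul ℂ] at h3
    exact (smul_eq_zero.1 h3).resolve_left two_ne_zero
  refine (WithLp.ofLp_injective 2) (Prod.ext ?_ ?_)
  · exact h5.trans h6
  · exact h6

/-- Integration by parts in `H¹`. -/
theorem HasWeakDeriv.inner_eq_neg {v v₁ w w₁ : L2} (hv : HasWeakDeriv v v₁)
    (hw : HasWeakDeriv w w₁) : inner ℂ v₁ w = -inner ℂ v w₁ := by
  let N : Submodule ℂ (WithLp 2 (L2 × L2)) := (ℂ ∙ WithLp.toLp 2 (w₁, w))ᗮ
  have hN : (Submodule.span ℂ testPairs).topologicalClosure ≤ N := by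
    refine Submodule.topologicalClosure_minimal _ (Submodule.span_le.2 ?_)
      (Submodule.isClosed_orthogonal _)
    rintro _ ⟨η, hη, hs, rfl⟩
    refine Submodule.mem_orthogonal_singleton_iff_inner_left.2 ?_
    rw [WithLp.prod_inner_apply]
    have := hasWeakDeriv_iff_inner.1 hw η hη hs
    rw [eq_neg_iff_add_eq_zero, add_comm] at this
    exact this
  have hmem : WithLp.toLp 2 (v, v₁) ∈ N :=
    hN (weakDerivGraph_le_topologicalClosure (show WithLp.toLp 2 (v, v₁) ∈ weakDerivGraph from hv))
  have := Submodule.mem_orthogonal_singleton_iff_inner_left.1 hmem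
  rw [WithLp.prod_inner_apply] at this
  rw [eq_neg_iff_add_eq_zero, add_comm]
  exact this

/-- `H²` is dense in `H¹`. -/
theorem HasWeakDeriv.exists_approx {v v₁ : L2} (hv : HasWeakDeriv v v₁) {ε : ℝ} (hε : 0 < ε) :
    ∃ u u₁ u₂ : L2, HasWeakDeriv u u₁ ∧ HasWeakDeriv u₁ u₂ ∧ ‖v - u‖ < ε ∧ ‖v₁ - u₁‖ < ε := by
  have hmem : WithLp.toLp 2 (v, v₁) ∈ (Submodule.span ℂ testPairs).topologicalClosure :=
    weakDerivGraph_le_topologicalClosure (show WithLp.toLp 2 (v, v₁) ∈ weakDerivGraph from hv)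
  obtain ⟨p, hp, hd⟩ := Metric.mem_closure_iff.1 hmem ε hε
  have hp' : HasWeakDeriv p.fst p.snd ∧ ∃ u₂, HasWeakDeriv p.snd u₂ := by
    refine Submodule.span_induction ?_ ?_ ?_ ?_ hp
    · rintro _ ⟨η, hη, hs, rfl⟩
      have hη' := contDiff_deriv_test hη
      exact ⟨hasWeakDeriv_test hη hs, _, hasWeakDeriv_test hη' hs.deriv⟩
    · exact ⟨HasWeakDeriv.zero, 0, HasWeakDeriv.zero⟩
    · rintro x y _ _ ⟨h1, u, h2⟩ ⟨h1', u', h2'⟩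
      exact ⟨h1.add h1', _, h2.add h2'⟩
    · rintro z x _ ⟨h1, u, h2⟩
      exact ⟨h1.smul z, _, h2.smul z⟩
  obtain ⟨h1, u₂, h2⟩ := hp'
  rw [dist_eq_norm] at hd
  refine ⟨p.fst, p.snd, u₂, h1, h2, ?_, ?_⟩
  · exact (WithLp.norm_fst_le _ (WithLp.toLp 2 (v, v₁) - p)).trans_lt hd
  · exact (WithLp.norm_snd_le _ (WithLp.toLp 2 (v, v₁) - p)).trans_lt hd

/-! ### Bounded operators on `L²` -/

theorem norm_sq_eq_integral (v : L2) : ‖v‖ ^ 2 = ∫ x, ‖v x‖ ^ 2 := by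
  have h : ((‖v‖ ^ 2 : ℝ) : ℂ) = ((∫ x, ‖v x‖ ^ 2 : ℝ) : ℂ) := by
    have h1 := inner_self_eq_norm_sq_to_K (𝕜 := ℂ) v
    rw [L2.inner_def] at h1
    rw [← integral_complex_ofReal]
    push_cast
    refine h1.symm.trans (integral_congr_ae (Eventually.of_forall fun x => ?_))
    simp
  exact_mod_cast h

theorem integrable_norm_sq (v : L2) : Integrable (fun x => ‖v x‖ ^ 2) :=
  (Lp.memLp v).integrable_norm_pow (by norm_num)

theorem memLp_top_of_continuous_of_bound {p : ℝ → ℝ} (hp : Continuous p) {C : ℝ}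
    (hC : ∀ x, |p x| ≤ C) : MemLp p ⊤ (volume : Measure ℝ) :=
  memLp_top_of_bound hp.aestronglyMeasurable C (Eventually.of_forall hC)

/-- Multiplication by a bounded real function. -/
noncomputable def mulOp (p : ℝ → ℝ) (hp : MemLp p ⊤ (volume : Measure ℝ)) : L2 →L[ℂ] L2 :=
  (ContinuousLinearMap.mul ℂ ℂ).holderL volume ⊤ 2 2 ((hp.ofReal (K := ℂ)).toLp _)

theorem coeFn_mulOp {p : ℝ → ℝ} (hp : MemLp p ⊤ (volume : Measure ℝ)) (v : L2) :
    mulOp p hp v =ᵐ[volume] fun x => p x • v x := by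
  have h := (ContinuousLinearMap.mul ℂ ℂ).coeFn_holder (r := 2) ((hp.ofReal (K := ℂ)).toLp _) v
  filter_upwards [h, (hp.ofReal (K := ℂ)).coeFn_toLp] with x hx hx'
  refine hx.trans ?_
  rw [hx']
  simp

theorem inner_mulOp_left {p : ℝ → ℝ} (hp : MemLp p ⊤ (volume : Measure ℝ)) (u v : L2) :
    inner ℂ (mulOp p hp u) v = inner ℂ u (mulOp p hp v) := by
  rw [L2.inner_def, L2.inner_def]
  refine integral_congr_ae ?_
  filter_upwards [coeFn_mulOp hp u, coeFn_mulOp hp v] with x h1 h2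
  rw [h1, h2]
  simp only [Complex.real_smul, RCLike.inner_apply, map_mul, Complex.conj_ofReal]
  ring

theorem inner_mulOp_self {p : ℝ → ℝ} (hp : MemLp p ⊤ (volume : Measure ℝ)) (v : L2) :
    inner ℂ v (mulOp p hp v) = ((∫ x, p x * ‖v x‖ ^ 2 : ℝ) : ℂ) := by
  rw [L2.inner_def, ← integral_complex_ofReal]
  refine integral_congr_ae ?_
  filter_upwards [coeFn_mulOp hp v] with x h1
  rw [h1]
  simp only [Complex.real_smul, RCLike.inner_apply, mul_assoc, Complex.mul_conj,
    Complex.normSq_eq_norm_sq]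
  push_cast
  ring

theorem integrable_mul_norm_sq {p : ℝ → ℝ} (hp : MemLp p ⊤ (volume : Measure ℝ)) (v : L2) :
    Integrable (fun x => p x * ‖v x‖ ^ 2) :=
  (integrable_norm_sq v).mul_of_top_right hp

/-- The Leibniz rule for a smooth coefficient and an `H¹` function. -/
theorem HasWeakDeriv.mulOp {v v₁ : L2} (h : HasWeakDeriv v v₁) {p : ℝ → ℝ}
    (hsm : ContDiff ℝ ∞ p) (hp : MemLp p ⊤ (volume : Measure ℝ))
    (hp' : MemLp (deriv p) ⊤ (volume : Measure ℝ)) :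
    HasWeakDeriv (mulOp p hp v) (mulOp p hp v₁ + mulOp (deriv p) hp' v) := by
  intro η hη hs
  have hdp := contDiff_deriv_test hsm
  have hdη := contDiff_deriv_test hη
  have key := h (fun x => η x * p x) (hη.mul hsm) hs.mul_right
  have hd : ∀ x, deriv (fun x => η x * p x) x = deriv η x * p x + η x * deriv p x := fun x =>
    ((hasDerivAt_test hη x).mul (hasDerivAt_test hsm x)).deriv
  have i1 := integrable_mul_coe v (η := fun x => deriv η x * p x)
    (hdη.continuous.mul hsm.continuous) hs.deriv.mul_right
  have i2 := integrable_mul_coe v (η := fun x => η x * deriv p x)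
    (hη.continuous.mul hdp.continuous) hs.mul_right
  have i3 := integrable_mul_coe v₁ (η := fun x => η x * p x)
    (hη.continuous.mul hsm.continuous) hs.mul_right
  simp only [hd, add_smul] at key
  rw [integral_add i1 i2] at key
  have e1 : ∫ x, deriv η x • Novikov.mulOp p hp v x = ∫ x, (deriv η x * p x) • v x := by
    refine integral_congr_ae ?_
    filter_upwards [coeFn_mulOp hp v] with x hx
    rw [hx, mul_smul]
  have e2 : ∫ x, η x • (Novikov.mulOp p hp v₁ + Novikov.mulOp (deriv p) hp' v : L2) x =
      ∫ x, ((η x * p x) • v₁ x + (η x * deriv p x) • v x) := by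
    refine integral_congr_ae ?_
    filter_upwards [coeFn_mulOp hp v₁, coeFn_mulOp hp' v,
      Lp.coeFn_add (Novikov.mulOp p hp v₁) (Novikov.mulOp (deriv p) hp' v)] with x h1 h2 h3
    rw [h3, Pi.add_apply, h1, h2, smul_add, mul_smul, mul_smul]
  rw [e1, e2, integral_add i3 i2, neg_add, ← key]
  abel

/-! ### The Green's function of `1 - ∂ₓ²` -/

theorem integrable_green (x : ℝ) : Integrable (fun y => Real.exp (-|x - y|) / 2) := by
  have h0 : Integrable (fun t : ℝ => Real.exp (-|t|)) := by
    by_contra hn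
    have h := integral_comp_abs (f := fun t => Real.exp (-t))
    rw [integral_undef hn, integral_exp_neg_Ioi] at h
    norm_num at h
  exact (h0.comp_sub_left x).div_const 2

/-- `(1 - ∂ₓ²)⁻¹ (f - f'') = f` for bounded `f` with bounded derivatives: on each side of `x` the
integrand is the derivative of `∓e^{-|x - y|} (f ± f')`. -/
theorem helmholtzInv_sub_deriv2 {f f' f'' : ℝ → ℝ} (hf : ∀ x, HasDerivAt f (f' x) x)
    (hf' : ∀ x, HasDerivAt f' (f'' x) x) (hc : Continuous f'') {C : ℝ} (h0 : ∀ x, |f x| ≤ C)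
    (h1 : ∀ x, |f' x| ≤ C) (h2 : ∀ x, |f'' x| ≤ C) (x : ℝ) :
    helmholtzInv (fun y => f y - f'' y) x = f x := by
  have cf : Continuous f := continuous_iff_continuousAt.2 fun x => (hf x).continuousAt
  have int : Integrable (fun y => (Real.exp (-|x - y|) / 2) * (f y - f'' y)) := by
    refine (integrable_green x).mul_bdd (c := 2 * C) (cf.sub hc).aestronglyMeasurable
      (Eventually.of_forall fun y => ?_)
    rw [Real.norm_eq_abs]
    have := abs_sub (f y) (f'' y)
    linarith [h0 y, h2 y]
  have eR : ∫ y in Set.Ioi x, (Real.exp (-|x - y|) / 2) * (f y - f'' y) =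
      (f x + f' x) / 2 := by
    have e : ∫ y in Set.Ioi x, (Real.exp (-|x - y|) / 2) * (f y - f'' y) =
        ∫ y in Set.Ioi x, (Real.exp (x - y) / 2) * (f y - f'' y) := by
      refine setIntegral_congr_fun measurableSet_Ioi fun y hy => ?_
      have hy' : x < y := hy
      simp only [abs_of_neg (sub_neg.2 hy'), neg_neg]
    have i : IntegrableOn (fun y => (Real.exp (x - y) / 2) * (f y - f'' y)) (Set.Ioi x) := by
      refine int.integrableOn.congr_fun (fun y hy => ?_) measurableSet_Ioi
      have hy' : x < y := hy
      simp only [abs_of_neg (sub_neg.2 hy'), neg_neg]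
    have hd : ∀ y ∈ Set.Ici x, HasDerivAt (fun y => -(Real.exp (x - y) / 2) * (f y + f' y))
        ((Real.exp (x - y) / 2) * (f y - f'' y)) y := by
      intro y _
      have he : HasDerivAt (fun y => Real.exp (x - y)) (-Real.exp (x - y)) y := by
        simpa using ((hasDerivAt_id y).const_sub x).exp
      refine ((he.div_const 2).neg.mul ((hf y).add (hf' y))).congr_deriv ?_
      simp only [Pi.add_apply, Pi.neg_apply]
      ring
    have ht : Tendsto (fun y => -(Real.exp (x - y) / 2) * (f y + f' y)) atTop (𝓝 0) := by
      have hz : Tendsto (fun y => C * Real.exp (x - y)) atTop (𝓝 0) := by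
        have : Tendsto (fun y => x - y) atTop atBot := by
          simpa [sub_eq_add_neg] using tendsto_atBot_add_const_left _ x tendsto_neg_atTop_atBot
        simpa using (Real.tendsto_exp_atBot.comp this).const_mul C
      refine squeeze_zero_norm (fun y => ?_) hz
      rw [norm_mul, norm_neg, Real.norm_of_nonneg (by positivity), Real.norm_eq_abs]
      have := abs_add_le (f y) (f' y)
      have := mul_le_mul_of_nonneg_left
        (show |f y + f' y| ≤ 2 * C by linarith [h0 y, h1 y]) (Real.exp_pos (x - y)).le
      linarith
    rw [e, integral_Ioi_of_hasDerivAt_of_tendsto' hd i ht]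
    simp
    ring
  have eL : ∫ y in Set.Iic x, (Real.exp (-|x - y|) / 2) * (f y - f'' y) =
      (f x - f' x) / 2 := by
    have e : ∫ y in Set.Iic x, (Real.exp (-|x - y|) / 2) * (f y - f'' y) =
        ∫ y in Set.Iic x, (Real.exp (y - x) / 2) * (f y - f'' y) := by
      refine setIntegral_congr_fun measurableSet_Iic fun y hy => ?_
      have hy' : y ≤ x := hy
      simp only [abs_of_nonneg (sub_nonneg.2 hy'), neg_sub]
    have i : IntegrableOn (fun y => (Real.exp (y - x) / 2) * (f y - f'' y)) (Set.Iic x) := by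
      refine int.integrableOn.congr_fun (fun y hy => ?_) measurableSet_Iic
      have hy' : y ≤ x := hy
      simp only [abs_of_nonneg (sub_nonneg.2 hy'), neg_sub]
    have hd : ∀ y ∈ Set.Iic x, HasDerivAt (fun y => (Real.exp (y - x) / 2) * (f y - f' y))
        ((Real.exp (y - x) / 2) * (f y - f'' y)) y := by
      intro y _
      have he : HasDerivAt (fun y => Real.exp (y - x)) (Real.exp (y - x)) y := by
        simpa using ((hasDerivAt_id y).sub_const x).exp
      refine ((he.div_const 2).mul ((hf y).sub (hf' y))).congr_deriv ?_
      simp only [Pi.sub_apply]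
      ring
    have ht : Tendsto (fun y => (Real.exp (y - x) / 2) * (f y - f' y)) atBot (𝓝 0) := by
      have hz : Tendsto (fun y => C * Real.exp (y - x)) atBot (𝓝 0) := by
        have : Tendsto (fun y : ℝ => y - x) atBot atBot :=
          tendsto_atBot_add_const_right _ (-x) tendsto_id
        simpa using (Real.tendsto_exp_atBot.comp this).const_mul C
      refine squeeze_zero_norm (fun y => ?_) hz
      rw [norm_mul, Real.norm_of_nonneg (by positivity), Real.norm_eq_abs]
      have := abs_sub (f y) (f' y)
      have := mul_le_mul_of_nonneg_left
        (show |f y - f' y| ≤ 2 * C by linarith [h0 y, h1 y]) (Real.exp_pos (y - x)).le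
      linarith
    rw [e, integral_Iic_of_hasDerivAt_of_tendsto' hd i ht]
    simp
    ring
  have : helmholtzInv (fun y => f y - f'' y) x =
      ∫ y, (Real.exp (-|x - y|) / 2) * (f y - f'' y) := rfl
  rw [this, ← integral_add_compl measurableSet_Iic int, Set.compl_Iic, eL, eR]
  ring

theorem integral_green (x : ℝ) : ∫ y, Real.exp (-|x - y|) / 2 = 1 := by
  have := helmholtzInv_sub_deriv2 (f := fun _ => 1) (f' := fun _ => 0) (f'' := fun _ => 0)
    (fun x => hasDerivAt_const x 1) (fun x => hasDerivAt_const x 0) continuous_const (C := 1)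
    (by simp) (by simp) (by simp) x
  simpa [helmholtzInv] using this

theorem helmholtzInv_ofReal (f : ℝ → ℝ) (x : ℝ) :
    helmholtzInv (fun y => (f y : ℂ)) x = ((helmholtzInv f x : ℝ) : ℂ) := by
  simp only [helmholtzInv]
  rw [← integral_complex_ofReal]
  refine integral_congr_ae (Eventually.of_forall fun y => ?_)
  simp

/-! ### `(1 - ∂ₓ²)⁻¹` as a bounded self-adjoint operator on `L²` -/

theorem integrable_prod_green_mul {f : ℝ → ℝ} (hf : Integrable f) :
    Integrable (fun p : ℝ × ℝ => (Real.exp (-|p.1 - p.2|) / 2) * f p.2)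
      (volume.prod volume) := by
  have h := Integrable.convolution_integrand (ContinuousLinearMap.mul ℝ ℝ) hf
    (integrable_green 0) (μ := volume)
  refine h.congr (Eventually.of_forall fun p => ?_)
  simp only [ContinuousLinearMap.mul_apply', zero_sub, abs_neg]
  ring

theorem integral_integral_green_mul {f : ℝ → ℝ} (hf : Integrable f) :
    ∫ x, ∫ y, (Real.exp (-|x - y|) / 2) * f y = ∫ y, f y := by
  rw [integral_integral_swap (f := fun x y => (Real.exp (-|x - y|) / 2) * f y)
    (integrable_prod_green_mul hf)]
  refine integral_congr_ae (Eventually.of_forall fun y => ?_)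
  simp only
  rw [integral_mul_const]
  simp_rw [abs_sub_comm _ y]
  rw [integral_green, one_mul]

/-- The Cauchy-Schwarz inequality for the probability density `e^{-|x - y|} / 2`, obtained by
integrating `(‖v y‖ - m)² ≥ 0` with `m` the mean of `‖v‖`. -/
theorem norm_sq_helmholtzInv_le (v : L2) (x : ℝ) :
    ‖helmholtzInv v x‖ ^ 2 ≤ ∫ y, (Real.exp (-|x - y|) / 2) * ‖v y‖ ^ 2 := by
  set g : ℝ → ℝ := fun y => Real.exp (-|x - y|) / 2
  have hg0 : ∀ y, 0 ≤ g y := fun y => by positivity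
  have hg1 : ∀ y, g y ≤ 1 := fun y => by
    have : Real.exp (-|x - y|) ≤ 1 := Real.exp_le_one_iff.2 (by simp)
    simp only [g]; linarith
  have hgc : Continuous g := by fun_prop
  have ig : Integrable g := integrable_green x
  have i1 : Integrable (fun y => g y * ‖v y‖) := by
    refine (integrable_kernel_mul_coe v x).norm.congr (Eventually.of_forall fun y => ?_)
    simp only [norm_smul, Real.norm_of_nonneg (hg0 y), g]
  have i2 : Integrable (fun y => g y * ‖v y‖ ^ 2) :=
    (integrable_norm_sq v).bdd_mul (c := 1) hgc.aestronglyMeasurable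
      (Eventually.of_forall fun y => by rw [Real.norm_of_nonneg (hg0 y)]; exact hg1 y)
  set m := ∫ y, g y * ‖v y‖ with hm
  have h1 : ‖helmholtzInv v x‖ ≤ m := by
    refine (norm_integral_le_integral_norm _).trans_eq ?_
    refine integral_congr_ae (Eventually.of_forall fun y => ?_)
    simp only [norm_smul, Real.norm_of_nonneg (hg0 y), g]
  have h2 : 0 ≤ ∫ y, g y * (‖v y‖ - m) ^ 2 :=
    integral_nonneg fun y => mul_nonneg (hg0 y) (sq_nonneg _)
  have h3 : ∫ y, g y * (‖v y‖ - m) ^ 2 = (∫ y, g y * ‖v y‖ ^ 2) - m ^ 2 := by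
    have e : (fun y => g y * (‖v y‖ - m) ^ 2) =
        fun y => g y * ‖v y‖ ^ 2 - 2 * m * (g y * ‖v y‖) + m ^ 2 * g y := by
      funext y; ring
    rw [e, integral_add (f := fun y => g y * ‖v y‖ ^ 2 - 2 * m * (g y * ‖v y‖))
      (i2.sub (i1.const_mul _)) (ig.const_mul _),
      integral_sub i2 (i1.const_mul _), integral_const_mul, integral_const_mul, integral_green x,
      ← hm]
    ring
  have h4 : ‖helmholtzInv v x‖ ^ 2 ≤ m ^ 2 := by gcongr
  linarith

theorem aestronglyMeasurable_helmholtzInv (v : L2) :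
    AEStronglyMeasurable (helmholtzInv v) (volume : Measure ℝ) := by
  have : AEStronglyMeasurable
      (fun p : ℝ × ℝ => (Real.exp (-|p.1 - p.2|) / 2) • (v : ℝ → ℂ) p.2)
      ((volume : Measure ℝ).prod volume) :=
    (by fun_prop : Continuous fun p : ℝ × ℝ =>
      Real.exp (-|p.1 - p.2|) / 2).aestronglyMeasurable.smul (Lp.aestronglyMeasurable v).comp_snd
  exact this.integral_prod_right'

theorem integrable_norm_sq_helmholtzInv (v : L2) :
    Integrable (fun x => ‖helmholtzInv v x‖ ^ 2) := by
  refine (integrable_prod_green_mul (integrable_norm_sq v)).integral_prod_left.mono'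
    ((aestronglyMeasurable_helmholtzInv v).norm.pow 2) (Eventually.of_forall fun x => ?_)
  rw [Real.norm_of_nonneg (by positivity)]
  exact norm_sq_helmholtzInv_le v x

theorem memLp_helmholtzInv (v : L2) : MemLp (helmholtzInv v) 2 (volume : Measure ℝ) :=
  (memLp_two_iff_integrable_sq_norm (aestronglyMeasurable_helmholtzInv v)).2
    (integrable_norm_sq_helmholtzInv v)

/-- `(1 - ∂ₓ²)⁻¹` as a contraction of `L²`. -/
noncomputable def helmholtzOp : L2 →L[ℂ] L2 :=
  LinearMap.mkContinuous
    { toFun := fun v => (memLp_helmholtzInv v).toLp _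
      map_add' := fun v w => by
        rw [← MemLp.toLp_add]
        exact MemLp.toLp_congr _ _ (Eventually.of_forall fun x => helmholtzInv_add v w x)
      map_smul' := fun z v => by
        rw [RingHom.id_apply, ← MemLp.toLp_const_smul]
        exact MemLp.toLp_congr _ _ (Eventually.of_forall fun x => helmholtzInv_smul z v x) }
    1 (fun v => by
      rw [one_mul]
      refine le_of_sq_le_sq ?_ (norm_nonneg _)
      rw [norm_sq_eq_integral, norm_sq_eq_integral,
        ← integral_integral_green_mul (integrable_norm_sq v)]
      have e : ∫ x, ‖(memLp_helmholtzInv v).toLp _ x‖ ^ 2 = ∫ x, ‖helmholtzInv v x‖ ^ 2 := by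
        refine integral_congr_ae ?_
        filter_upwards [(memLp_helmholtzInv v).coeFn_toLp] with x hx
        rw [hx]
      refine e.trans_le ?_
      exact integral_mono (integrable_norm_sq_helmholtzInv v)
        (integrable_prod_green_mul (integrable_norm_sq v)).integral_prod_left
        (norm_sq_helmholtzInv_le v))

theorem coeFn_helmholtzOp (v : L2) : helmholtzOp v =ᵐ[volume] helmholtzInv v :=
  (memLp_helmholtzInv v).coeFn_toLp

theorem inner_helmholtzOp_left (u v : L2) :
    inner ℂ (helmholtzOp u) v = inner ℂ u (helmholtzOp v) := by
  have key : ∀ u v : L2, Integrable (fun p : ℝ × ℝ =>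
      (Real.exp (-|p.1 - p.2|) / 2) • (starRingEnd ℂ (u p.2) * v p.1)) (volume.prod volume) := by
    intro u v
    have i1 := integrable_prod_green_mul (integrable_norm_sq u)
    have i2 : Integrable (fun p : ℝ × ℝ => (Real.exp (-|p.1 - p.2|) / 2) * ‖v p.1‖ ^ 2)
        (volume.prod volume) := by
      refine (integrable_prod_green_mul (integrable_norm_sq v)).swap.congr
        (Eventually.of_forall fun p => ?_)
      simp [abs_sub_comm p.2 p.1]
    refine (i1.add i2).mono' ?_ (Eventually.of_forall fun p => ?_)
    · refine (by fun_prop : Continuous fun p : ℝ × ℝ =>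
        Real.exp (-|p.1 - p.2|) / 2).aestronglyMeasurable.smul ?_
      exact (Complex.continuous_conj.comp_aestronglyMeasurable
        (Lp.aestronglyMeasurable u).comp_snd).mul (Lp.aestronglyMeasurable v).comp_fst
    · have h : 0 ≤ Real.exp (-|p.1 - p.2|) / 2 := by positivity
      rw [norm_smul, norm_mul, RCLike.norm_conj, Real.norm_of_nonneg h, Pi.add_apply, ← mul_add]
      refine mul_le_mul_of_nonneg_left ?_ h
      nlinarith [sq_nonneg (‖u p.2‖ - ‖v p.1‖), sq_nonneg ‖u p.2‖, sq_nonneg ‖v p.1‖]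
  have e1 : inner ℂ (helmholtzOp u) v =
      ∫ x, ∫ y, (Real.exp (-|x - y|) / 2) • (starRingEnd ℂ (u y) * v x) := by
    rw [L2.inner_def]
    refine integral_congr_ae ?_
    filter_upwards [coeFn_helmholtzOp u] with x hx
    rw [hx, RCLike.inner_apply, helmholtzInv, ← integral_conj, ← integral_const_mul]
    refine integral_congr_ae (Eventually.of_forall fun y => ?_)
    simp only [Complex.real_smul, map_mul, Complex.conj_ofReal]
    ring
  have e2 : inner ℂ u (helmholtzOp v) =
      ∫ y, ∫ x, (Real.exp (-|x - y|) / 2) • (starRingEnd ℂ (u y) * v x) := by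
    rw [L2.inner_def]
    refine integral_congr_ae ?_
    filter_upwards [coeFn_helmholtzOp v] with y hy
    rw [hy, RCLike.inner_apply, helmholtzInv, ← integral_mul_const]
    refine integral_congr_ae (Eventually.of_forall fun x => ?_)
    simp only [Complex.real_smul, abs_sub_comm x y]
    ring
  rw [e1, e2]
  exact integral_integral_swap
    (f := fun x y => (Real.exp (-|x - y|) / 2) • (starRingEnd ℂ (u y) * v x)) (key u v)

/-! ### The travelling wave as a solution of a second-order equation -/

theorem paramA_eq {c k : ℝ} (h : k ^ 2 ≤ c) : paramA c k = k * √(c - k ^ 2) ^ 3 := by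
  rw [paramA, Real.sqrt_eq_rpow, ← Real.rpow_natCast (_ ^ (1 / 2 : ℝ)),
    ← Real.rpow_mul (by linarith)]
  norm_num

/-- A differentiable function with a limit at infinity has small slopes along some sequence. -/
theorem exists_tendsto_deriv_zero {f f' : ℝ → ℝ} (hf : ∀ x, HasDerivAt f (f' x) x) {l : ℝ}
    (h : Tendsto f atTop (𝓝 l)) :
    ∃ ξ : ℕ → ℝ, Tendsto ξ atTop atTop ∧ Tendsto (fun n => f' (ξ n)) atTop (𝓝 0) := by
  have hmv : ∀ n : ℕ, ∃ x ∈ Set.Ioo (n : ℝ) (n + 1), f' x = f (n + 1) - f n := by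
    intro n
    obtain ⟨x, hx, e⟩ := exists_hasDerivAt_eq_slope f f' (by linarith : (n : ℝ) < n + 1)
      (fun x _ => (hf x).continuousAt.continuousWithinAt) (fun x _ => hf x)
    exact ⟨x, hx, by simpa using e⟩
  choose ξ hξ e using hmv
  refine ⟨ξ, tendsto_atTop_mono (fun n => (hξ n).1.le) tendsto_natCast_atTop_atTop, ?_⟩
  simp only [e]
  have h1 := h.comp tendsto_natCast_atTop_atTop (α := ℕ)
  have h2 := h.comp (tendsto_atTop_add_const_right _ 1 (tendsto_natCast_atTop_atTop (R := ℝ)))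
  simpa using h2.sub h1

/-- The second-order system behind the solitary wave, with `φ'` the derivative of `φ` and
`q = (c - φ²)^{-1/2}`; all coefficients of the Hessian are polynomials in `φ`, `φ'` and `q`. -/
structure Profile (c k : ℝ) (φ φ' q : ℝ → ℝ) : Prop where
  pos : 0 < k
  lt : 4 * k ^ 2 < c
  smooth : ContDiff ℝ ∞ φ
  hasDerivAt : ∀ x, HasDerivAt φ (φ' x) x
  hasDerivAt' : ∀ x, HasDerivAt φ' (φ x - paramA c k * q x ^ 3) x
  q_pos : ∀ x, 0 < q x
  q_sq : ∀ x, q x ^ 2 * (c - φ x ^ 2) = 1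
  momentum_eq : ∀ x, momentum φ x = paramA c k * q x ^ 3
  energy : ∀ x, φ' x ^ 2 = φ x ^ 2 - 2 * paramA c k / c * φ x * q x + 2 * paramE c k
  tendsto_cocompact : Tendsto φ (cocompact ℝ) (𝓝 k)
  nonconstant : ∃ x, φ x ≠ k

theorem hasDerivAt_inv_sqrt {c : ℝ} {φ φ' : ℝ → ℝ} {x : ℝ} (h : HasDerivAt φ (φ' x) x)
    (hx : φ x ^ 2 < c) :
    HasDerivAt (fun y => (√(c - φ y ^ 2))⁻¹) (φ x * φ' x * (√(c - φ x ^ 2))⁻¹ ^ 3) x := by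
  have hp : 0 < c - φ x ^ 2 := sub_pos.2 hx
  have hs : 0 < √(c - φ x ^ 2) := Real.sqrt_pos.2 hp
  refine ((((h.pow 2).const_sub c).sqrt hp.ne').inv hs.ne').congr_deriv ?_
  simp only [Pi.pow_apply]
  field_simp
  push_cast
  ring

/-- The equation for `μ = φ - φ''` obtained by inserting `φ(x - ct)` into the Novikov equation. -/
theorem IsSmoothSolitaryWave.ode {c k : ℝ} {φ : ℝ → ℝ} (h : IsSmoothSolitaryWave c k φ) (x : ℝ) :
    (c - φ x ^ 2) * (deriv φ x - iteratedDeriv 3 φ x) =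
      3 * φ x * deriv φ x * (φ x - iteratedDeriv 2 φ x) := by
  have key := h.isSolution 0 x
  have hd : ∀ n : ℕ, Differentiable ℝ (iteratedDeriv n φ) := fun n =>
    h.smooth.differentiable_iteratedDeriv n (by exact_mod_cast WithTop.coe_lt_top _)
  have shift : ∀ (n : ℕ) (s y : ℝ),
      iteratedDeriv n (fun x => φ (x - c * s)) y = iteratedDeriv n φ (y - c * s) := by
    intro n s y
    rw [iteratedDeriv_comp_sub_const]
  have time : ∀ n : ℕ, deriv (fun s => iteratedDeriv n φ (x - c * s)) 0 =
      -c * iteratedDeriv (n + 1) φ x := by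
    intro n
    have h1 : HasDerivAt (fun s : ℝ => x - c * s) (-c) 0 := by
      simpa using ((hasDerivAt_id (0 : ℝ)).const_mul c).const_sub x
    have h2 : HasDerivAt (iteratedDeriv n φ) (iteratedDeriv (n + 1) φ (x - c * 0)) (x - c * 0) := by
      rw [iteratedDeriv_succ]
      exact (hd n _).hasDerivAt
    have := (h2.comp 0 h1).deriv
    rw [mul_zero, sub_zero] at this
    rw [← mul_comm]
    exact this
  have t0 := time 0
  simp only [iteratedDeriv_zero, zero_add, iteratedDeriv_one] at t0
  simp only [shift, time 2, t0, mul_zero, sub_zero] at key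
  linarith

theorem IsSmoothSolitaryWave.exists_profile {c k : ℝ} {φ : ℝ → ℝ} (hk : 0 < k)
    (hck : 4 * k ^ 2 < c) (h : IsSmoothSolitaryWave c k φ) :
    Profile c k φ (deriv φ) (fun x => (√(c - φ x ^ 2))⁻¹) := by
  have hc : 0 < c := by nlinarith [sq_nonneg k]
  have hρ2 : 0 < c - k ^ 2 := by nlinarith [sq_nonneg k]
  set ρ : ℝ := √(c - k ^ 2) with hρ
  have hρ0 : 0 < ρ := Real.sqrt_pos.2 hρ2
  have hρs : ρ ^ 2 = c - k ^ 2 := Real.sq_sqrt hρ2.le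
  have ha : paramA c k = k * ρ ^ 3 := paramA_eq (by linarith)
  have hsm : ∀ n : ℕ, Differentiable ℝ (iteratedDeriv n φ) := fun n =>
    h.smooth.differentiable_iteratedDeriv n (by exact_mod_cast WithTop.coe_lt_top _)
  set φ' := deriv φ with hφ'
  set q : ℝ → ℝ := fun x => (√(c - φ x ^ 2))⁻¹ with hq
  have hpos : ∀ x, 0 < √(c - φ x ^ 2) := fun x => Real.sqrt_pos.2 (sub_pos.2 (h.sq_lt x))
  have q_pos : ∀ x, 0 < q x := fun x => inv_pos.2 (hpos x)
  have q_sq : ∀ x, q x ^ 2 * (c - φ x ^ 2) = 1 := by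
    intro x
    have h1 : √(c - φ x ^ 2) ^ 2 = c - φ x ^ 2 := Real.sq_sqrt (sub_pos.2 (h.sq_lt x)).le
    have h2 := (hpos x).ne'
    simp only [hq]
    rw [inv_pow, h1, inv_mul_cancel₀ (sub_pos.2 (h.sq_lt x)).ne']
  have d0 : ∀ x, HasDerivAt φ (φ' x) x := hasDerivAt_test h.smooth
  have d1 : ∀ x, HasDerivAt φ' (iteratedDeriv 2 φ x) x := by
    intro x
    have := (hsm 1 x).hasDerivAt
    rwa [← iteratedDeriv_succ, iteratedDeriv_one] at this
  have d2 : ∀ x, HasDerivAt (iteratedDeriv 2 φ) (iteratedDeriv 3 φ x) x := by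
    intro x
    have := (hsm 2 x).hasDerivAt
    rwa [← iteratedDeriv_succ] at this
  have dq : ∀ x, HasDerivAt q (φ x * φ' x * q x ^ 3) x := fun x =>
    hasDerivAt_inv_sqrt (d0 x) (h.sq_lt x)
  -- `μ (c - φ²)^{3/2}` is a first integral
  obtain ⟨A, hA⟩ : ∃ A, ∀ x, momentum φ x = A * q x ^ 3 := by
    have hd : ∀ x, HasDerivAt (fun y => momentum φ y * (c - φ y ^ 2) ^ 2 * q y) 0 x := by
      intro x
      have dm : HasDerivAt (momentum φ) (φ' x - iteratedDeriv 3 φ x) x := (d0 x).sub (d2 x)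
      refine ((dm.mul ((((d0 x).pow 2).const_sub c).pow 2)).mul (dq x)).congr_deriv ?_
      have e := h.ode x
      have e2 := q_sq x
      simp only [momentum, Pi.mul_apply, Pi.pow_apply] at *
      push_cast
      linear_combination (c - φ x ^ 2) * q x * e +
        (c - φ x ^ 2) * q x * (φ x - iteratedDeriv 2 φ x) * φ x * φ' x * e2
    refine ⟨momentum φ 0 * (c - φ 0 ^ 2) ^ 2 * q 0, fun x => ?_⟩
    have := is_const_of_deriv_eq_zero (fun x => (hd x).differentiableAt)
      (fun x => (hd x).deriv) 0 x
    rw [this]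
    have e2 := q_sq x
    linear_combination (-(momentum φ x) * (q x ^ 2 * (c - φ x ^ 2) + 1)) * e2
  have hφ2 : ∀ x, iteratedDeriv 2 φ x = φ x - A * q x ^ 3 := fun x => by
    rw [← hA]; simp [momentum]
  -- the energy integral
  obtain ⟨e, he⟩ : ∃ e, ∀ x, φ' x ^ 2 = φ x ^ 2 - 2 * A / c * φ x * q x + e := by
    have hd : ∀ x, HasDerivAt (fun y => φ' y ^ 2 - φ y ^ 2 + 2 * A / c * (φ y * q y)) 0 x := by
      intro x
      refine ((((d1 x).pow 2).sub ((d0 x).pow 2)).add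
        (((d0 x).mul (dq x)).const_mul (2 * A / c))).congr_deriv ?_
      rw [hφ2]
      have e2 := q_sq x
      push_cast
      field_simp
      linear_combination (- 2 * A * φ' x * q x) * e2
    refine ⟨φ' 0 ^ 2 - φ 0 ^ 2 + 2 * A / c * (φ 0 * q 0), fun x => ?_⟩
    have := is_const_of_deriv_eq_zero (fun x => (hd x).differentiableAt)
      (fun x => (hd x).deriv) 0 x
    rw [this]
    ring
  have tq : Tendsto q atTop (𝓝 ρ⁻¹) :=
    ((tendsto_const_nhds.sub (h.tendsto_atTop.pow 2)).sqrt).inv₀ hρ0.ne'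
  have tsq : Tendsto (fun x => φ' x ^ 2) atTop (𝓝 (k ^ 2 - 2 * A / c * k * ρ⁻¹ + e)) := by
    simp only [he]
    exact ((h.tendsto_atTop.pow 2).sub ((h.tendsto_atTop.const_mul _).mul tq)).add_const e
  -- the limit of `φ'²` is zero because `φ` has small slopes along a sequence
  have hlim0 : k ^ 2 - 2 * A / c * k * ρ⁻¹ + e = 0 := by
    obtain ⟨ξ, hξ, hξ'⟩ := exists_tendsto_deriv_zero d0 h.tendsto_atTop
    have := tendsto_nhds_unique (tsq.comp hξ) (hξ'.pow 2)
    simpa using this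
  have t1 : Tendsto φ' atTop (𝓝 0) := by
    rw [hlim0] at tsq
    have := tsq.sqrt
    simp only [Real.sqrt_sq_eq_abs, Real.sqrt_zero] at this
    exact (tendsto_zero_iff_abs_tendsto_zero _).2 this
  have hAa : A = paramA c k := by
    obtain ⟨ξ, hξ, hξ'⟩ := exists_tendsto_deriv_zero d1 t1
    have t2 : Tendsto (iteratedDeriv 2 φ) atTop (𝓝 (k - A * ρ⁻¹ ^ 3)) := by
      rw [funext hφ2]
      exact h.tendsto_atTop.sub ((tq.pow 3).const_mul A)
    have := tendsto_nhds_unique (t2.comp hξ) hξ'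
    rw [ha]
    field_simp at this
    linarith
  have heE : e = 2 * paramE c k := by
    rw [hAa, ha] at hlim0
    rw [paramE]
    field_simp at hlim0 ⊢
    rw [hρs] at hlim0
    linear_combination hlim0
  refine ⟨hk, hck, h.smooth, d0, fun x => ?_, q_pos, q_sq, fun x => ?_, fun x => ?_, ?_,
    h.nonconstant⟩
  · rw [← hAa, ← hφ2]; exact d1 x
  · rw [← hAa]; exact hA x
  · rw [← hAa, ← heE]; exact he x
  · rw [cocompact_eq_atBot_atTop]
    exact h.tendsto_atBot.sup h.tendsto_atTop

/-! ### Bounded continuous coefficients -/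

/-- `f` is continuous and bounded. -/
@[fun_prop]
structure IsBddCont (f : ℝ → ℝ) : Prop where
  continuous : Continuous f
  bounded : ∃ C, ∀ x, |f x| ≤ C

namespace IsBddCont

variable {f g : ℝ → ℝ}

@[fun_prop]
theorem const (a : ℝ) : IsBddCont fun _ => a := ⟨continuous_const, |a|, fun _ => le_rfl⟩

@[fun_prop]
theorem add (hf : IsBddCont f) (hg : IsBddCont g) : IsBddCont fun x => f x + g x := by
  obtain ⟨C, hC⟩ := hf.bounded
  obtain ⟨D, hD⟩ := hg.bounded
  exact ⟨hf.continuous.add hg.continuous, C + D, fun x =>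
    (abs_add_le _ _).trans (add_le_add (hC x) (hD x))⟩

@[fun_prop]
theorem mul (hf : IsBddCont f) (hg : IsBddCont g) : IsBddCont fun x => f x * g x := by
  obtain ⟨C, hC⟩ := hf.bounded
  obtain ⟨D, hD⟩ := hg.bounded
  exact ⟨hf.continuous.mul hg.continuous, C * D, fun x => by
    rw [abs_mul]
    exact mul_le_mul (hC x) (hD x) (abs_nonneg _) ((abs_nonneg _).trans (hC x))⟩

@[fun_prop]
theorem neg (hf : IsBddCont f) : IsBddCont fun x => -f x := by
  simpa using (const (-1)).mul hf

@[fun_prop]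
theorem sub (hf : IsBddCont f) (hg : IsBddCont g) : IsBddCont fun x => f x - g x := by
  simpa [sub_eq_add_neg] using hf.add hg.neg

@[fun_prop]
theorem pow (hf : IsBddCont f) (n : ℕ) : IsBddCont fun x => f x ^ n := by
  induction n with
  | zero => simpa using const 1
  | succ n ih => simpa only [pow_succ] using ih.mul hf

theorem of_tendsto (hf : Continuous f) {l : ℝ} (h : Tendsto f (cocompact ℝ) (𝓝 l)) :
    IsBddCont f := by
  refine ⟨hf, ?_⟩
  have hb := hf.isBounded_range_iff_isBigO.2 (h.isBigO_one ℝ)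
  obtain ⟨C, hC⟩ := isBounded_iff_forall_norm_le.1 hb
  exact ⟨C, fun x => hC _ ⟨x, rfl⟩⟩

theorem memLp_top (hf : IsBddCont f) : MemLp f ⊤ (volume : Measure ℝ) := by
  obtain ⟨C, hC⟩ := hf.bounded
  exact memLp_top_of_continuous_of_bound hf.continuous hC

theorem memLp_mul (hg : IsBddCont g) (hf : MemLp f 2 (volume : Measure ℝ)) :
    MemLp (fun x => f x * g x) 2 (volume : Measure ℝ) :=
  hg.memLp_top.mul hf

end IsBddCont

/-! ### Square integrability of decaying solutions -/

/-- If `ψ'' = M ψ` with `M ≥ κ > 0` near `+∞` and `ψ ψ' → 0`, then `(ψ ψ')' ≥ ψ'² + κ ψ²` makes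
`ψ` and `ψ'` square integrable. -/
theorem integrableOn_Ioi_sq_of_second_order {ψ ψ' M : ℝ → ℝ} (h0 : ∀ x, HasDerivAt ψ (ψ' x) x)
    (h1 : ∀ x, HasDerivAt ψ' (ψ x * M x) x) {κ : ℝ} (hκ : 0 < κ) (hM : ∀ᶠ x in atTop, κ ≤ M x)
    (ht : Tendsto (fun x => ψ x * ψ' x) atTop (𝓝 0)) :
    IntegrableOn (fun x => ψ x ^ 2) (Set.Ioi 0) ∧ IntegrableOn (fun x => ψ' x ^ 2) (Set.Ioi 0) := by
  obtain ⟨X, hX⟩ := eventually_atTop.1 hM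
  have c0 : Continuous ψ := continuous_iff_continuousAt.2 fun x => (h0 x).continuousAt
  have c1 : Continuous ψ' := continuous_iff_continuousAt.2 fun x => (h1 x).continuousAt
  set Y := max X 0
  have key : IntegrableOn (fun x => ψ' x * ψ' x + ψ x * (ψ x * M x)) (Set.Ioi Y) := by
    refine integrableOn_Ioi_deriv_of_nonneg' (fun x _ => (h0 x).mul (h1 x)) (fun x hx => ?_) ht
    have : κ ≤ M x := hX x ((le_max_left _ _).trans (le_of_lt hx))
    nlinarith [mul_self_nonneg (ψ' x), mul_self_nonneg (ψ x), mul_nonneg (mul_self_nonneg (ψ x))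
      (hκ.le.trans this)]
  have ext : ∀ f : ℝ → ℝ, Continuous f → IntegrableOn f (Set.Ioi Y) →
      IntegrableOn f (Set.Ioi 0) := by
    intro f hf hi
    rw [← Set.Ioc_union_Ioi_eq_Ioi (le_max_right X 0)]
    exact (hf.integrableOn_Icc.mono_set Set.Ioc_subset_Icc_self).union hi
  constructor
  · refine ext _ (by fun_prop) ((key.const_mul (1 / κ)).mono' (by fun_prop) ?_)
    refine (ae_restrict_iff' measurableSet_Ioi).2 (Eventually.of_forall fun x hx => ?_)
    have : κ ≤ M x := hX x ((le_max_left _ _).trans (le_of_lt hx))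
    rw [Real.norm_of_nonneg (sq_nonneg _), one_div, ← div_eq_inv_mul, le_div_iff₀ hκ]
    nlinarith [mul_self_nonneg (ψ' x), mul_self_nonneg (ψ x),
      mul_le_mul_of_nonneg_left this (mul_self_nonneg (ψ x))]
  · refine ext _ (by fun_prop) (key.mono' (by fun_prop) ?_)
    refine (ae_restrict_iff' measurableSet_Ioi).2 (Eventually.of_forall fun x hx => ?_)
    have : κ ≤ M x := hX x ((le_max_left _ _).trans (le_of_lt hx))
    rw [Real.norm_of_nonneg (sq_nonneg _)]
    nlinarith [mul_nonneg (mul_self_nonneg (ψ x)) (hκ.le.trans this)]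

theorem memLp_of_second_order {ψ ψ' M : ℝ → ℝ} (h0 : ∀ x, HasDerivAt ψ (ψ' x) x)
    (h1 : ∀ x, HasDerivAt ψ' (ψ x * M x) x) {κ : ℝ} (hκ : 0 < κ)
    (hM : ∀ᶠ x in cocompact ℝ, κ ≤ M x)
    (ht : Tendsto (fun x => ψ x * ψ' x) (cocompact ℝ) (𝓝 0)) :
    MemLp ψ 2 (volume : Measure ℝ) ∧ MemLp ψ' 2 (volume : Measure ℝ) := by
  have c0 : Continuous ψ := continuous_iff_continuousAt.2 fun x => (h0 x).continuousAt
  have c1 : Continuous ψ' := continuous_iff_continuousAt.2 fun x => (h1 x).continuousAt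
  rw [memLp_two_iff_integrable_sq c0.aestronglyMeasurable,
    memLp_two_iff_integrable_sq c1.aestronglyMeasurable]
  obtain ⟨r0, r1⟩ := integrableOn_Ioi_sq_of_second_order h0 h1 hκ
    (hM.filter_mono atTop_le_cocompact)
    (ht.mono_left atTop_le_cocompact)
  -- the left half-line is handled by reflection
  have n0 : ∀ x, HasDerivAt (fun x => ψ (-x)) (-ψ' (-x)) x := fun x =>
    ((h0 (-x)).comp x (hasDerivAt_neg x)).congr_deriv (by ring)
  have n1 : ∀ x, HasDerivAt (fun x => -ψ' (-x)) (ψ (-x) * M (-x)) x := fun x =>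
    ((h1 (-x)).comp x (hasDerivAt_neg x)).neg.congr_deriv (by ring)
  obtain ⟨l0, l1⟩ := integrableOn_Ioi_sq_of_second_order n0 n1 hκ
    (tendsto_neg_atTop_atBot.eventually (hM.filter_mono atBot_le_cocompact))
    (by
      have := ((ht.mono_left atBot_le_cocompact).comp tendsto_neg_atTop_atBot).neg
      simpa [Function.comp_def] using this)
  have glue : ∀ f : ℝ → ℝ, IntegrableOn f (Set.Ioi 0) →
      IntegrableOn (fun x => f (-x)) (Set.Ioi 0) → Integrable f := by
    intro f hr hl
    have hl' : IntegrableOn f (Set.Iio 0) := by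
      have := (Measure.measurePreserving_neg (volume : Measure ℝ)).integrableOn_comp_preimage
        (Homeomorph.neg ℝ).measurableEmbedding (f := f) (s := Set.Iio 0)
      refine this.1 ?_
      have e : (Neg.neg ⁻¹' Set.Iio 0 : Set ℝ) = Set.Ioi 0 := by ext x; simp
      rw [e]
      exact hl
    rw [← integrableOn_univ, ← Set.Iic_union_Ioi (a := (0 : ℝ))]
    exact ((integrableOn_Iic_iff_integrableOn_Iio (by simp)).2 hl').union hr
  refine ⟨glue _ r0 l0, glue _ r1 ?_⟩
  simpa using l1

/-! ### Regularity and decay of the solitary wave -/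

namespace Profile

variable {c k : ℝ} {φ φ' q : ℝ → ℝ}

theorem c_pos (h : Profile c k φ φ' q) : 0 < c := by nlinarith [h.lt, sq_nonneg k]

theorem sub_pos (h : Profile c k φ φ' q) : 0 < c - k ^ 2 := by nlinarith [h.lt, sq_nonneg k]

theorem sq_lt (h : Profile c k φ φ' q) (x : ℝ) : 0 < c - φ x ^ 2 := by
  have h1 := h.q_sq x
  have h2 : 0 < q x ^ 2 := pow_pos (h.q_pos x) 2
  by_contra hn
  nlinarith [mul_nonneg h2.le (neg_nonneg.2 (not_lt.1 hn))]

theorem q_eq (h : Profile c k φ φ' q) (x : ℝ) : q x = (√(c - φ x ^ 2))⁻¹ := by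
  rw [← Real.sqrt_inv, ← Real.sqrt_sq (h.q_pos x).le]
  congr 1
  exact eq_inv_of_mul_eq_one_left (h.q_sq x)

theorem paramA_pos (h : Profile c k φ φ' q) : 0 < paramA c k :=
  mul_pos h.pos (Real.rpow_pos_of_pos h.sub_pos _)

theorem hasDerivAt_q (h : Profile c k φ φ' q) (x : ℝ) :
    HasDerivAt q (φ x * φ' x * q x ^ 3) x := by
  have e : q = fun x => (√(c - φ x ^ 2))⁻¹ := funext h.q_eq
  rw [h.q_eq x, e]
  exact hasDerivAt_inv_sqrt (h.hasDerivAt x) (by linarith [h.sq_lt x])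

theorem continuous (h : Profile c k φ φ' q) : Continuous φ := h.smooth.continuous

theorem continuous' (h : Profile c k φ φ' q) : Continuous φ' :=
  continuous_iff_continuousAt.2 fun x => (h.hasDerivAt' x).continuousAt

theorem continuous_q (h : Profile c k φ φ' q) : Continuous q :=
  continuous_iff_continuousAt.2 fun x => (h.hasDerivAt_q x).continuousAt

theorem tendsto_q (h : Profile c k φ φ' q) :
    Tendsto q (cocompact ℝ) (𝓝 (√(c - k ^ 2))⁻¹) := by
  rw [funext h.q_eq]
  exact ((tendsto_const_nhds.sub (h.tendsto_cocompact.pow 2)).sqrt).inv₀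
    (Real.sqrt_pos.2 h.sub_pos).ne'

theorem tendsto_deriv (h : Profile c k φ φ' q) : Tendsto φ' (cocompact ℝ) (𝓝 0) := by
  have hρ := Real.sqrt_pos.2 h.sub_pos
  have hρs : √(c - k ^ 2) ^ 2 = c - k ^ 2 := Real.sq_sqrt h.sub_pos.le
  have hc := h.c_pos
  have t : Tendsto (fun x => φ' x ^ 2) (cocompact ℝ)
      (𝓝 (k ^ 2 - 2 * paramA c k / c * k * (√(c - k ^ 2))⁻¹ + 2 * paramE c k)) := by
    simp only [h.energy]
    exact ((h.tendsto_cocompact.pow 2).sub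
      ((h.tendsto_cocompact.const_mul _).mul h.tendsto_q)).add_const _
  have e : k ^ 2 - 2 * paramA c k / c * k * (√(c - k ^ 2))⁻¹ + 2 * paramE c k = 0 := by
    rw [paramA_eq (by linarith [h.sub_pos]), paramE]
    field_simp
    rw [hρs]
    ring
  rw [e] at t
  have := t.sqrt
  simp only [Real.sqrt_sq_eq_abs, Real.sqrt_zero] at this
  exact (tendsto_zero_iff_abs_tendsto_zero _).2 this

theorem isBddCont (h : Profile c k φ φ' q) : IsBddCont φ :=
  .of_tendsto h.continuous h.tendsto_cocompact

theorem isBddCont' (h : Profile c k φ φ' q) : IsBddCont φ' :=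
  .of_tendsto h.continuous' h.tendsto_deriv

theorem isBddCont_q (h : Profile c k φ φ' q) : IsBddCont q := .of_tendsto h.continuous_q h.tendsto_q

/-- The factor `S` in `q - (c - k²)^{-1/2} = (φ - k) S`. -/
theorem exists_q_sub_eq (h : Profile c k φ φ' q) : ∃ S : ℝ → ℝ, IsBddCont S ∧
    (∀ x, q x - (√(c - k ^ 2))⁻¹ = (φ x - k) * S x) ∧
    Tendsto S (cocompact ℝ) (𝓝 (k * (√(c - k ^ 2))⁻¹ ^ 3)) := by
  set ρ := √(c - k ^ 2)
  have hρ : 0 < ρ := Real.sqrt_pos.2 h.sub_pos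
  have hρs : ρ ^ 2 = c - k ^ 2 := Real.sq_sqrt h.sub_pos.le
  have hr : ∀ x, 0 < √(c - φ x ^ 2) := fun x => Real.sqrt_pos.2 (h.sq_lt x)
  have hT : Tendsto (fun x => q x * ρ⁻¹ * (φ x + k) * (√(c - φ x ^ 2) + ρ)⁻¹) (cocompact ℝ)
      (𝓝 (k * ρ⁻¹ ^ 3)) := by
    have h1 := ((tendsto_const_nhds (x := c)).sub (h.tendsto_cocompact.pow 2)).sqrt
    have h2 := ((h.tendsto_q.mul_const ρ⁻¹).mul (h.tendsto_cocompact.add_const k)).mul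
      ((h1.add_const ρ).inv₀ (by change ρ + ρ ≠ 0; positivity))
    have e : ρ⁻¹ * ρ⁻¹ * (k + k) * (ρ + ρ)⁻¹ = k * ρ⁻¹ ^ 3 := by
      field_simp
    rw [← e]
    exact h2
  refine ⟨fun x => q x * ρ⁻¹ * (φ x + k) * (√(c - φ x ^ 2) + ρ)⁻¹, .of_tendsto ?_ hT, fun x => ?_,
    hT⟩
  · have c0 := h.continuous
    have c1 := h.continuous_q
    have c2 : Continuous fun x => √(c - φ x ^ 2) := by fun_prop
    exact ((c1.mul_const _).mul (c0.add_const _)).mul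
      ((c2.add_const _).inv₀ fun x => (add_pos (hr x) hρ).ne')
  · have hrs : √(c - φ x ^ 2) ^ 2 = c - φ x ^ 2 := Real.sq_sqrt (h.sq_lt x).le
    have h1 := hr x
    simp only [h.q_eq x]
    set r := √(c - φ x ^ 2)
    field_simp
    linear_combination hρs - hrs

/-- The linearisation of `φ'' = φ - a q³` at the rest state `k` has the positive coefficient
`(c - 4k²) / (c - k²)`. -/
theorem exists_deriv2_eq (h : Profile c k φ φ' q) : ∃ M : ℝ → ℝ, IsBddCont M ∧
    (∀ x, φ x - paramA c k * q x ^ 3 = (φ x - k) * M x) ∧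
    Tendsto M (cocompact ℝ) (𝓝 ((c - 4 * k ^ 2) / (c - k ^ 2))) := by
  obtain ⟨S, hS, hSe, hSt⟩ := h.exists_q_sub_eq
  set ρ := √(c - k ^ 2)
  have hρ : 0 < ρ := Real.sqrt_pos.2 h.sub_pos
  have hρs : ρ ^ 2 = c - k ^ 2 := Real.sq_sqrt h.sub_pos.le
  have ha : paramA c k = k * ρ ^ 3 := paramA_eq (by linarith [h.sub_pos])
  have hq := h.isBddCont_q
  refine ⟨fun x => 1 - paramA c k * (q x ^ 2 + q x * ρ⁻¹ + ρ⁻¹ ^ 2) * S x, by fun_prop,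
    fun x => ?_, ?_⟩
  · have e := hSe x
    have e1 : k = paramA c k * ρ⁻¹ ^ 3 := by rw [ha]; field_simp
    linear_combination (-(paramA c k) * (q x ^ 2 + q x * ρ⁻¹ + ρ⁻¹ ^ 2)) * e + e1
  · have h1 := (((((h.tendsto_q.pow 2).add (h.tendsto_q.mul_const ρ⁻¹)).add_const
      (ρ⁻¹ ^ 2)).const_mul (paramA c k)).mul hSt).const_sub 1
    have e : 1 - paramA c k * (ρ⁻¹ ^ 2 + ρ⁻¹ * ρ⁻¹ + ρ⁻¹ ^ 2) * (k * ρ⁻¹ ^ 3) =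
        (c - 4 * k ^ 2) / (c - k ^ 2) := by
      rw [ha, ← hρs]
      field_simp
      rw [hρs]
      ring
    rw [← e]
    exact h1

theorem memLp (h : Profile c k φ φ' q) :
    MemLp (fun x => φ x - k) 2 (volume : Measure ℝ) ∧ MemLp φ' 2 (volume : Measure ℝ) := by
  obtain ⟨M, hM, hMe, hMt⟩ := h.exists_deriv2_eq
  have hκ : 0 < (c - 4 * k ^ 2) / (c - k ^ 2) := div_pos (by linarith [h.lt]) h.sub_pos
  refine memLp_of_second_order (M := M) (fun x => (h.hasDerivAt x).sub_const k) (fun x => ?_)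
    (half_pos hκ) ((hMt.eventually_const_lt (half_lt_self hκ)).mono fun x hx => hx.le) ?_
  · rw [← hMe]; exact h.hasDerivAt' x
  · simpa using (h.tendsto_cocompact.sub_const k).mul h.tendsto_deriv

theorem memLp_deriv2 (h : Profile c k φ φ' q) :
    MemLp (fun x => φ x - paramA c k * q x ^ 3) 2 (volume : Measure ℝ) := by
  obtain ⟨M, hM, hMe, -⟩ := h.exists_deriv2_eq
  simp only [hMe]
  exact hM.memLp_mul h.memLp.1

theorem momentum_fun (h : Profile c k φ φ' q) :
    momentum φ = fun x => paramA c k * q x ^ 3 := funext h.momentum_eq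

/-! ### The coefficients of the Hessian -/

theorem momentum_rpow (h : Profile c k φ φ' q) (s : ℝ) (x : ℝ) :
    momentum φ x ^ s = paramA c k ^ s * q x ^ (3 * s) := by
  rw [h.momentum_eq, Real.mul_rpow h.paramA_pos.le (by have := h.q_pos x; positivity),
    ← Real.rpow_natCast, ← Real.rpow_mul (h.q_pos x).le]
  norm_num

theorem momentum_rpow_neg_two_mul (h : Profile c k φ φ' q) {s : ℝ} {n : ℕ} (hs : 3 * s = -(2 * n))
    (x : ℝ) : momentum φ x ^ s = paramA c k ^ s * (c - φ x ^ 2) ^ n := by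
  rw [h.momentum_rpow, hs, Real.rpow_neg (h.q_pos x).le, Real.rpow_mul (h.q_pos x).le,
    Real.rpow_natCast, Real.rpow_two, ← inv_pow, ← eq_inv_of_mul_eq_one_right (h.q_sq x)]

theorem momentum_rpow_neg_eight_thirds (h : Profile c k φ φ' q) (x : ℝ) :
    momentum φ x ^ (-8 / 3 : ℝ) = paramA c k ^ (-8 / 3 : ℝ) * (c - φ x ^ 2) ^ 4 :=
  h.momentum_rpow_neg_two_mul (by norm_num) x

theorem hasDerivAt_momentum (h : Profile c k φ φ' q) (x : ℝ) :
    HasDerivAt (momentum φ) (3 * paramA c k * (φ x * φ' x * q x ^ 5)) x := by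
  rw [h.momentum_fun]
  refine (((h.hasDerivAt_q x).pow 3).const_mul (paramA c k)).congr_deriv ?_
  push_cast
  ring

theorem hasDerivAt_momentum' (h : Profile c k φ φ' q) (x : ℝ) :
    HasDerivAt (fun x => 3 * paramA c k * (φ x * φ' x * q x ^ 5))
      (3 * paramA c k * ((φ' x ^ 2 + φ x * (φ x - paramA c k * q x ^ 3)) * q x ^ 5
        + 5 * φ x ^ 2 * φ' x ^ 2 * q x ^ 7)) x := by
  refine ((((h.hasDerivAt x).mul (h.hasDerivAt' x)).mul
    ((h.hasDerivAt_q x).pow 5)).const_mul (3 * paramA c k)).congr_deriv ?_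
  simp only [Pi.mul_apply, Pi.pow_apply]
  push_cast
  ring

theorem hasDerivAt_momentum'' (h : Profile c k φ φ' q) (x : ℝ) :
    HasDerivAt (fun x => 3 * paramA c k *
        ((φ' x ^ 2 + φ x * (φ x - paramA c k * q x ^ 3)) * q x ^ 5
        + 5 * φ x ^ 2 * φ' x ^ 2 * q x ^ 7))
      (φ' x * (3 * paramA c k *
        ((3 * (φ x - paramA c k * q x ^ 3) + φ x * (1 - 3 * paramA c k * φ x * q x ^ 5)) * q x ^ 5
        + 5 * (φ' x ^ 2 + φ x * (φ x - paramA c k * q x ^ 3)) * φ x * q x ^ 7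
        + 10 * (φ x * φ' x ^ 2 + φ x ^ 2 * (φ x - paramA c k * q x ^ 3)) * q x ^ 7
        + 35 * φ x ^ 3 * φ' x ^ 2 * q x ^ 9))) x := by
  have d0 := h.hasDerivAt x
  have d1 := h.hasDerivAt' x
  have dq := h.hasDerivAt_q x
  refine ((((d1.pow 2).add (d0.mul (d0.sub ((dq.pow 3).const_mul (paramA c k))))).mul
    (dq.pow 5)).add ((((d0.pow 2).const_mul 5).mul (d1.pow 2)).mul (dq.pow 7))).const_mul
    (3 * paramA c k) |>.congr_deriv ?_
  simp only [Pi.mul_apply, Pi.pow_apply, Pi.add_apply, Pi.sub_apply]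
  push_cast
  ring

theorem deriv_momentum (h : Profile c k φ φ' q) :
    deriv (momentum φ) = fun x => 3 * paramA c k * (φ x * φ' x * q x ^ 5) :=
  funext fun x => (h.hasDerivAt_momentum x).deriv

theorem iteratedDeriv_momentum (h : Profile c k φ φ' q) :
    iteratedDeriv 2 (momentum φ) = fun x =>
      3 * paramA c k * ((φ' x ^ 2 + φ x * (φ x - paramA c k * q x ^ 3)) * q x ^ 5
        + 5 * φ x ^ 2 * φ' x ^ 2 * q x ^ 7) := by
  rw [iteratedDeriv_succ, iteratedDeriv_one, h.deriv_momentum]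
  exact funext fun x => (h.hasDerivAt_momentum' x).deriv

theorem memLp_deriv_momentum (h : Profile c k φ φ' q) :
    MemLp (fun x => 3 * paramA c k * (φ x * φ' x * q x ^ 5)) 2 (volume : Measure ℝ) := by
  have b0 := h.isBddCont
  have bq := h.isBddCont_q
  have := IsBddCont.memLp_mul (g := fun x => 3 * paramA c k * (φ x * q x ^ 5)) (by fun_prop)
    h.memLp.2
  refine (memLp_congr_ae (Eventually.of_forall fun x => ?_)).1 this
  ring

theorem memLp_deriv_momentum' (h : Profile c k φ φ' q) :
    MemLp (fun x => 3 * paramA c k *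
      ((φ' x ^ 2 + φ x * (φ x - paramA c k * q x ^ 3)) * q x ^ 5
        + 5 * φ x ^ 2 * φ' x ^ 2 * q x ^ 7)) 2 (volume : Measure ℝ) := by
  have b0 := h.isBddCont
  have b1 := h.isBddCont'
  have bq := h.isBddCont_q
  have h1 := IsBddCont.memLp_mul (g := fun x => 3 * paramA c k * (φ' x * q x ^ 5
    + 5 * φ x ^ 2 * φ' x * q x ^ 7)) (by fun_prop) h.memLp.2
  have h2 := IsBddCont.memLp_mul (g := fun x => 3 * paramA c k * φ x * q x ^ 5) (by fun_prop)
    h.memLp_deriv2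
  refine (memLp_congr_ae (Eventually.of_forall fun x => ?_)).1 (h1.add h2)
  simp only [Pi.add_apply]
  ring

theorem memLp_deriv_momentum'' (h : Profile c k φ φ' q) :
    MemLp (fun x => φ' x * (3 * paramA c k *
        ((3 * (φ x - paramA c k * q x ^ 3) + φ x * (1 - 3 * paramA c k * φ x * q x ^ 5)) * q x ^ 5
        + 5 * (φ' x ^ 2 + φ x * (φ x - paramA c k * q x ^ 3)) * φ x * q x ^ 7
        + 10 * (φ x * φ' x ^ 2 + φ x ^ 2 * (φ x - paramA c k * q x ^ 3)) * q x ^ 7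
        + 35 * φ x ^ 3 * φ' x ^ 2 * q x ^ 9))) 2 (volume : Measure ℝ) := by
  have b0 := h.isBddCont
  have b1 := h.isBddCont'
  have bq := h.isBddCont_q
  exact IsBddCont.memLp_mul (by fun_prop) h.memLp.2

theorem potential_eq (h : Profile c k φ φ' q) :
    potential c k φ = fun x => paramA c k ^ (-8 / 3 : ℝ) *
      ((2 / 3) * (24 * ((φ' x ^ 2 + φ x * (φ x - paramA c k * q x ^ 3)) * q x ^ 2
          + 5 * φ x ^ 2 * φ' x ^ 2 * q x ^ 4) - 132 * (φ x * φ' x * q x ^ 2) ^ 2 + 15)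
        * (c - φ x ^ 2) ^ 4 - 2 * c * (2 * paramE c k + c) * (c - φ x ^ 2) ^ 2) := by
  funext x
  have ha := h.paramA_pos
  have hq := h.q_pos x
  have hm : 0 < momentum φ x := by rw [h.momentum_eq]; positivity
  have e11 : momentum φ x ^ (-11 / 3 : ℝ) = momentum φ x ^ (-8 / 3 : ℝ) / momentum φ x := by
    rw [← Real.rpow_sub_one hm.ne']; norm_num
  have e14 : momentum φ x ^ (-14 / 3 : ℝ) =
      momentum φ x ^ (-8 / 3 : ℝ) / momentum φ x / momentum φ x := by
    rw [← Real.rpow_sub_one hm.ne', ← Real.rpow_sub_one hm.ne']; norm_num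
  have e4 : momentum φ x ^ (-4 / 3 : ℝ) = paramA c k ^ (-4 / 3 : ℝ) * (c - φ x ^ 2) ^ 2 :=
    h.momentum_rpow_neg_two_mul (by norm_num) x
  have ea : paramA c k ^ (-8 / 3 : ℝ) = paramA c k ^ (-4 / 3 : ℝ) * paramA c k ^ (-4 / 3 : ℝ) := by
    rw [← Real.rpow_add ha]; norm_num
  rw [potential, e11, e14, e4, h.momentum_rpow_neg_eight_thirds, h.deriv_momentum,
    h.iteratedDeriv_momentum, h.momentum_eq, omega1, ea]
  field_simp
  ring

theorem isBddCont_potential (h : Profile c k φ φ' q) : IsBddCont (potential c k φ) := by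
  have b0 := h.isBddCont
  have b1 := h.isBddCont'
  have bq := h.isBddCont_q
  rw [h.potential_eq]
  fun_prop

theorem principal_eq (h : Profile c k φ φ' q) :
    (fun x => momentum φ x ^ (-8 / 3 : ℝ)) =
      fun x => paramA c k ^ (-8 / 3 : ℝ) * (c - φ x ^ 2) ^ 4 :=
  funext h.momentum_rpow_neg_eight_thirds

theorem isBddCont_principal (h : Profile c k φ φ' q) :
    IsBddCont (fun x => momentum φ x ^ (-8 / 3 : ℝ)) := by
  have b0 := h.isBddCont
  rw [h.principal_eq]
  fun_prop

theorem contDiff_principal (h : Profile c k φ φ' q) :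
    ContDiff ℝ ∞ (fun x => momentum φ x ^ (-8 / 3 : ℝ)) := by
  rw [h.principal_eq]
  exact contDiff_const.mul ((contDiff_const.sub (h.smooth.pow 2)).pow 4)

theorem deriv_principal (h : Profile c k φ φ' q) :
    deriv (fun x => momentum φ x ^ (-8 / 3 : ℝ)) = fun x =>
      -8 * paramA c k ^ (-8 / 3 : ℝ) * ((c - φ x ^ 2) ^ 3 * φ x * φ' x) := by
  rw [h.principal_eq]
  funext x
  refine HasDerivAt.deriv ?_
  refine (((((h.hasDerivAt x).pow 2).const_sub c).pow 4).const_mul _).congr_deriv ?_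
  simp only [Pi.pow_apply]
  push_cast
  ring

theorem isBddCont_deriv_principal (h : Profile c k φ φ' q) :
    IsBddCont (deriv fun x => momentum φ x ^ (-8 / 3 : ℝ)) := by
  have b0 := h.isBddCont
  have b1 := h.isBddCont'
  rw [h.deriv_principal]
  fun_prop

theorem exists_le_principal (h : Profile c k φ φ' q) :
    ∃ m, 0 < m ∧ ∀ x, m ≤ momentum φ x ^ (-8 / 3 : ℝ) := by
  obtain ⟨Q, hQ⟩ := h.isBddCont_q.bounded
  have ha := h.paramA_pos
  have hQ0 : 0 < Q := (h.q_pos 0).trans_le ((le_abs_self _).trans (hQ 0))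
  refine ⟨paramA c k ^ (-8 / 3 : ℝ) * ((Q ^ 2)⁻¹) ^ 4, by positivity, fun x => ?_⟩
  rw [h.momentum_rpow_neg_eight_thirds]
  have hq := h.q_pos x
  have e : c - φ x ^ 2 = (q x ^ 2)⁻¹ := eq_inv_of_mul_eq_one_right (h.q_sq x)
  rw [e]
  have : q x ≤ Q := (le_abs_self _).trans (hQ x)
  gcongr

/-! ### The kernel and the constraint gradient -/

theorem helmholtzInv_momentum (h : Profile c k φ φ' q) (x : ℝ) :
    helmholtzInv (momentum φ) x = φ x := by
  have b0 := h.isBddCont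
  have b1 := h.isBddCont'
  have bq := h.isBddCont_q
  have b2 : IsBddCont fun x => φ x - paramA c k * q x ^ 3 := by fun_prop
  obtain ⟨C0, h0⟩ := b0.bounded
  obtain ⟨C1, h1⟩ := b1.bounded
  obtain ⟨C2, h2⟩ := b2.bounded
  have := helmholtzInv_sub_deriv2 h.hasDerivAt h.hasDerivAt' b2.continuous
    (C := max C0 (max C1 C2)) (fun x => (h0 x).trans (by simp)) (fun x => (h1 x).trans (by simp))
    (fun x => (h2 x).trans (by simp)) x
  simpa only [sub_sub_cancel, h.momentum_fun] using this

theorem helmholtzInv_deriv_momentum (h : Profile c k φ φ' q) (x : ℝ) :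
    helmholtzInv (fun x => 3 * paramA c k * (φ x * φ' x * q x ^ 5)) x = φ' x := by
  have b0 := h.isBddCont
  have b1 := h.isBddCont'
  have bq := h.isBddCont_q
  have b2 : IsBddCont fun x => φ x - paramA c k * q x ^ 3 := by fun_prop
  have b3 : IsBddCont fun x => φ' x - 3 * paramA c k * (φ x * φ' x * q x ^ 5) := by fun_prop
  obtain ⟨C0, h0⟩ := b1.bounded
  obtain ⟨C1, h1⟩ := b2.bounded
  obtain ⟨C2, h2⟩ := b3.bounded
  have d : ∀ x, HasDerivAt (fun x => φ x - paramA c k * q x ^ 3)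
      (φ' x - 3 * paramA c k * (φ x * φ' x * q x ^ 5)) x := fun x => by
    refine ((h.hasDerivAt x).sub (((h.hasDerivAt_q x).pow 3).const_mul _)).congr_deriv ?_
    push_cast
    ring
  have := helmholtzInv_sub_deriv2 h.hasDerivAt' d b3.continuous
    (C := max C0 (max C1 C2)) (fun x => (h0 x).trans (by simp)) (fun x => (h1 x).trans (by simp))
    (fun x => (h2 x).trans (by simp)) x
  simpa only [sub_sub_cancel] using this

/-- The equation `𝓛 μ' = 0`, written out; it is the derivative of the Euler-Lagrange equation of
the wave. After elimination of `c` and `E` it is an identity between rational functions of `φ`,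
`φ'` and `r = 1 / q`. -/
theorem hessian_deriv_momentum_eq_zero (h : Profile c k φ φ' q) (x : ℝ) :
    -2 * (momentum φ x ^ (-8 / 3 : ℝ) * (φ' x * (3 * paramA c k *
        ((3 * (φ x - paramA c k * q x ^ 3) + φ x * (1 - 3 * paramA c k * φ x * q x ^ 5)) * q x ^ 5
        + 5 * (φ' x ^ 2 + φ x * (φ x - paramA c k * q x ^ 3)) * φ x * q x ^ 7
        + 10 * (φ x * φ' x ^ 2 + φ x ^ 2 * (φ x - paramA c k * q x ^ 3)) * q x ^ 7
        + 35 * φ x ^ 3 * φ' x ^ 2 * q x ^ 9)))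
      + deriv (fun y => momentum φ y ^ (-8 / 3 : ℝ)) x * (3 * paramA c k *
      ((φ' x ^ 2 + φ x * (φ x - paramA c k * q x ^ 3)) * q x ^ 5
        + 5 * φ x ^ 2 * φ' x ^ 2 * q x ^ 7)))
      + potential c k φ x * (3 * paramA c k * (φ x * φ' x * q x ^ 5))
      + 2 * omega0 c k * φ' x = 0 := by
  have ha := h.paramA_pos
  have e0 : paramA c k ^ (-2 / 3 : ℝ) = paramA c k ^ (-8 / 3 : ℝ) * paramA c k ^ 2 := by
    rw [← Real.rpow_natCast, ← Real.rpow_add ha]; norm_num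
  rw [h.momentum_rpow_neg_eight_thirds, h.deriv_principal, h.potential_eq, omega0, e0]
  have hq := h.q_pos x
  have hs := h.q_sq x
  have he := h.energy x
  have hc := h.c_pos
  simp only
  generalize paramA c k ^ (-8 / 3 : ℝ) = B
  generalize paramE c k = E at *
  generalize paramA c k = a at *
  generalize φ x = s at *
  generalize φ' x = p at *
  obtain ⟨r, hr, hqr⟩ : ∃ r, 0 < r ∧ q x = r⁻¹ := ⟨(q x)⁻¹, inv_pos.2 hq, (inv_inv _).symm⟩
  rw [hqr] at hs he ⊢
  have hc' : c = r ^ 2 + s ^ 2 := by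
    field_simp at hs
    linarith
  have hE : E = (p ^ 2 - s ^ 2 + 2 * a / c * s * r⁻¹) / 2 := by linarith
  rw [hE]
  rw [hc'] at hc ⊢
  field_simp
  ring

/-- The translation mode `μ'` belongs to the kernel of the Hessian. -/
theorem deriv_momentum_mem_hessianGraph (h : Profile c k φ φ' q) :
    (ofRealLp _ h.memLp_deriv_momentum, (0 : L2)) ∈ hessianGraph c k φ := by
  refine ⟨ofRealLp _ h.memLp_deriv_momentum', ofRealLp _ h.memLp_deriv_momentum'',
    hasWeakDeriv_ofRealLp h.hasDerivAt_momentum' h.memLp_deriv_momentum h.memLp_deriv_momentum',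
    hasWeakDeriv_ofRealLp h.hasDerivAt_momentum'' h.memLp_deriv_momentum'
      h.memLp_deriv_momentum'', ?_⟩
  filter_upwards [coeFn_ofRealLp h.memLp_deriv_momentum, coeFn_ofRealLp h.memLp_deriv_momentum',
    coeFn_ofRealLp h.memLp_deriv_momentum'', Lp.coeFn_zero ℂ 2 (volume : Measure ℝ)]
    with x e0 e1 e2 e3
  rw [e3, hessianExpr, e0, e1, e2, helmholtzInv_congr (coeFn_ofRealLp h.memLp_deriv_momentum),
    helmholtzInv_ofReal, h.helmholtzInv_deriv_momentum, Pi.zero_apply]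
  simp only [Complex.real_smul, ← Complex.ofReal_mul, ← Complex.ofReal_add]
  rw [h.hessian_deriv_momentum_eq_zero, Complex.ofReal_zero]

theorem deriv_momentum_ne_zero (h : Profile c k φ φ' q) :
    ofRealLp _ h.memLp_deriv_momentum ≠ 0 := by
  intro h0
  have hae : (fun x => 3 * paramA c k * (φ x * φ' x * q x ^ 5)) =ᵐ[volume] fun _ => (0 : ℝ) := by
    rw [Lp.eq_zero_iff_ae_eq_zero] at h0
    filter_upwards [h0, coeFn_ofRealLp h.memLp_deriv_momentum] with x h1 h2
    rw [h1, Pi.zero_apply] at h2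
    exact_mod_cast h2.symm
  have c0 := h.continuous
  have c1 := h.continuous'
  have c2 := h.continuous_q
  have hall := Continuous.ae_eq_iff_eq volume (by fun_prop) continuous_const |>.1 hae
  -- `φ²` has zero derivative, so `φ = ±k`, and continuity excludes a change of sign
  have hz : ∀ x, φ x * φ' x = 0 := by
    intro x
    have h1 : 3 * paramA c k * (φ x * φ' x * q x ^ 5) = 0 := congrFun hall x
    have h2 : φ x * φ' x * (3 * paramA c k * q x ^ 5) = 0 := by linear_combination h1
    have ha := h.paramA_pos
    have hq := h.q_pos x
    exact (mul_eq_zero.1 h2).resolve_right (by positivity)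
  have hsq : ∀ x, φ x ^ 2 = k ^ 2 := by
    have hd : ∀ x, HasDerivAt (fun x => φ x ^ 2) 0 x := fun x => by
      refine ((h.hasDerivAt x).pow 2).congr_deriv ?_
      have := hz x
      push_cast
      linear_combination 2 * this
    have hconst : ∀ x, φ x ^ 2 = φ 0 ^ 2 := fun x =>
      is_const_of_deriv_eq_zero (fun x => (hd x).differentiableAt) (fun x => (hd x).deriv) x 0
    have ht : Tendsto (fun x => φ x ^ 2) (cocompact ℝ) (𝓝 (k ^ 2)) := h.tendsto_cocompact.pow 2
    simp only [hconst] at ht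
    intro x
    rw [hconst x]
    exact tendsto_nhds_unique tendsto_const_nhds ht
  have hpos : ∃ x, 0 < φ x :=
    (h.tendsto_cocompact.eventually (lt_mem_nhds h.pos)).exists
  obtain ⟨y, hy⟩ := hpos
  obtain ⟨x, hx⟩ := h.nonconstant
  have hx' : φ x = -k := (sq_eq_sq_iff_eq_or_eq_neg.1 (hsq x)).resolve_left hx
  obtain ⟨z, hz0⟩ := mem_range_of_exists_le_of_exists_ge c0
    ⟨x, by rw [hx']; linarith [h.pos]⟩ ⟨y, hy.le⟩
  have := hsq z
  rw [hz0] at this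
  have := pow_pos h.pos 2
  linarith

theorem constraintGradient_eq (h : Profile c k φ φ' q) (x : ℝ) :
    constraintGradient k φ x = 2 * φ x - 2 * (k * (√(c - k ^ 2))⁻¹) * (q x)⁻¹ := by
  have hρ : 0 < √(c - k ^ 2) := Real.sqrt_pos.2 h.sub_pos
  have e : k ^ (4 / 3 : ℝ) * paramA c k ^ (-1 / 3 : ℝ) = k * (√(c - k ^ 2))⁻¹ := by
    rw [paramA_eq (by linarith [h.sub_pos]), Real.mul_rpow h.pos.le (by positivity), ← mul_assoc,
      ← Real.rpow_add h.pos, ← Real.rpow_natCast, ← Real.rpow_mul hρ.le]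
    norm_num [Real.rpow_neg_one]
  rw [constraintGradient, h.helmholtzInv_momentum, h.momentum_rpow, ← e]
  have e1 : q x ^ (3 * (-1 / 3) : ℝ) = (q x)⁻¹ := by
    rw [← Real.rpow_neg_one]; norm_num
  rw [e1]
  ring

theorem memLp_constraintGradient (h : Profile c k φ φ' q) :
    MemLp (constraintGradient k φ) 2 (volume : Measure ℝ) := by
  obtain ⟨S, hS, hSe, -⟩ := h.exists_q_sub_eq
  have b0 := h.isBddCont
  have bq := h.isBddCont_q
  have hm := IsBddCont.memLp_mul (g := fun x => 2 + 2 * k * (S x * (q x * (c - φ x ^ 2))))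
    (by fun_prop) h.memLp.1
  refine (memLp_congr_ae (Eventually.of_forall fun x => ?_)).1 hm
  have e1 := hSe x
  have hq := h.q_pos x
  have e2 : q x * (c - φ x ^ 2) = (q x)⁻¹ := by
    refine eq_inv_of_mul_eq_one_right ?_
    linear_combination h.q_sq x
  have e3 : q x * (q x)⁻¹ = 1 := mul_inv_cancel₀ hq.ne'
  rw [h.constraintGradient_eq, e2]
  linear_combination (-2 * k * (q x)⁻¹) * e1 + 2 * k * e3

/-- The constraint functional is invariant under translations: its gradient is orthogonal to
`μ'`. -/
theorem integral_constraintGradient_mul_deriv_momentum (h : Profile c k φ φ' q) :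
    ∫ x, constraintGradient k φ x * (3 * paramA c k * (φ x * φ' x * q x ^ 5)) = 0 := by
  set ρ := √(c - k ^ 2)
  set P : ℝ → ℝ := fun x => φ x ^ 2 - 2 * (φ x * (φ x - paramA c k * q x ^ 3)) + φ' x ^ 2
    - 3 * paramA c k * (k * ρ⁻¹) * q x ^ 2
  have hP : ∀ x, HasDerivAt P
      (constraintGradient k φ x * (3 * paramA c k * (φ x * φ' x * q x ^ 5))) x := by
    intro x
    have d0 := h.hasDerivAt x
    have d1 := h.hasDerivAt' x
    have dq := h.hasDerivAt_q x
    refine ((((d0.pow 2).sub ((d0.mul (d0.sub ((dq.pow 3).const_mul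
      (paramA c k)))).const_mul 2)).add (d1.pow 2)).sub ((dq.pow 2).const_mul
      (3 * paramA c k * (k * ρ⁻¹)))).congr_deriv ?_
    have e3 : q x * (q x)⁻¹ = 1 := mul_inv_cancel₀ (h.q_pos x).ne'
    rw [h.constraintGradient_eq]
    simp only [Pi.sub_apply, Pi.pow_apply]
    push_cast
    linear_combination (6 * paramA c k * k * ρ⁻¹ * φ x * φ' x * q x ^ 4) * e3
  obtain ⟨l, hl⟩ : ∃ l, Tendsto P (cocompact ℝ) (𝓝 l) := by
    have t0 := h.tendsto_cocompact
    have t1 := h.tendsto_deriv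
    have tq := h.tendsto_q
    exact ⟨_, (((t0.pow 2).sub ((t0.mul (t0.sub ((tq.pow 3).const_mul
      (paramA c k)))).const_mul 2)).add (t1.pow 2)).sub ((tq.pow 2).const_mul
      (3 * paramA c k * (k * ρ⁻¹)))⟩
  rw [integral_of_hasDerivAt_of_tendsto hP
    (h.memLp_constraintGradient.integrable_mul h.memLp_deriv_momentum)
    (hl.mono_left atBot_le_cocompact) (hl.mono_left atTop_le_cocompact), sub_self]

end Profile

/-! ### The Hessian and its quadratic form -/

theorem mk_mem_hessianGraph {c k : ℝ} {φ : ℝ → ℝ} (x : (hessian c k φ).domain) :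
    ((x : L2), hessian c k φ x) ∈ hessianGraph c k φ := by
  rw [← graph_hessian]
  exact (hessian c k φ).mem_graph x

theorem exists_domain_of_mem_hessianGraph {c k : ℝ} {φ : ℝ → ℝ} {v f : L2}
    (h : (v, f) ∈ hessianGraph c k φ) :
    ∃ x : (hessian c k φ).domain, (x : L2) = v ∧ hessian c k φ x = f := by
  rw [← graph_hessian] at h
  exact (LinearPMap.mem_graph_iff _).1 h

namespace Profile

variable {c k : ℝ} {φ φ' q : ℝ → ℝ}

/-- The sesquilinear form `⟪v, 𝓛 w⟫` on `H¹`, where `v₁` and `w₁` are the weak derivatives. -/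
noncomputable def form (h : Profile c k φ φ' q) (v v₁ w w₁ : L2) : ℂ :=
  2 * inner ℂ v₁ (mulOp _ h.isBddCont_principal.memLp_top w₁) +
    inner ℂ v (mulOp _ h.isBddCont_potential.memLp_top w) +
    2 * omega0 c k * inner ℂ v (helmholtzOp w)

theorem form_conj (h : Profile c k φ φ' q) (v v₁ w w₁ : L2) :
    starRingEnd ℂ (h.form v v₁ w w₁) = h.form w w₁ v v₁ := by
  simp only [form, map_add, map_mul, inner_conj_symm, inner_mulOp_left, inner_helmholtzOp_left,
    Complex.conj_ofReal, map_ofNat]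

theorem continuous_form (h : Profile c k φ φ' q) :
    Continuous fun p : L2 × L2 => h.form p.1 p.2 p.1 p.2 := by
  unfold form
  fun_prop

theorem hessianForm_eq (h : Profile c k φ φ' q) (v v₁ : L2) :
    hessianForm c k φ v v₁ = (h.form v v₁ v v₁).re := by
  have e1 : ∫ x, 2 * momentum φ x ^ (-8 / 3 : ℝ) * ‖v₁ x‖ ^ 2 =
      2 * ∫ x, momentum φ x ^ (-8 / 3 : ℝ) * ‖v₁ x‖ ^ 2 := by
    rw [← integral_const_mul]
    simp only [mul_assoc]
  have e2 : ∫ x, helmholtzInv v x * (starRingEnd ℂ) (v x) = inner ℂ v (helmholtzOp v) := by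
    rw [L2.inner_def]
    refine integral_congr_ae ?_
    filter_upwards [coeFn_helmholtzOp v] with x hx
    rw [hx, RCLike.inner_apply]
  have e3 : (2 * (omega0 c k : ℂ)) = ((2 * omega0 c k : ℝ) : ℂ) := by push_cast; rfl
  rw [hessianForm, form, inner_mulOp_self, inner_mulOp_self, e1, e2, e3, Complex.add_re,
    Complex.add_re, Complex.re_ofReal_mul, Complex.ofReal_re]
  simp

/-- Every `v` in `H²` is in the domain, and `𝓛 v` is given by the stated expression. -/
theorem mem_hessianGraph_iff (h : Profile c k φ φ' q) {v v₁ v₂ f : L2} (h1 : HasWeakDeriv v v₁)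
    (h2 : HasWeakDeriv v₁ v₂) :
    (v, f) ∈ hessianGraph c k φ ↔
      f = (-2 : ℂ) • (mulOp _ h.isBddCont_principal.memLp_top v₂ +
          mulOp _ h.isBddCont_deriv_principal.memLp_top v₁) +
        mulOp _ h.isBddCont_potential.memLp_top v + (2 * omega0 c k : ℂ) • helmholtzOp v := by
  have key : ((-2 : ℂ) • (mulOp _ h.isBddCont_principal.memLp_top v₂ +
          mulOp _ h.isBddCont_deriv_principal.memLp_top v₁) +
        mulOp _ h.isBddCont_potential.memLp_top v + (2 * omega0 c k : ℂ) • helmholtzOp v : L2)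
      =ᵐ[volume] hessianExpr c k φ v v₁ v₂ := by
    set a := mulOp _ h.isBddCont_principal.memLp_top v₂
    set b := mulOp _ h.isBddCont_deriv_principal.memLp_top v₁
    set d := mulOp _ h.isBddCont_potential.memLp_top v
    set e := helmholtzOp v
    filter_upwards [Lp.coeFn_add ((-2 : ℂ) • (a + b) + d) ((2 * omega0 c k : ℂ) • e),
      Lp.coeFn_add ((-2 : ℂ) • (a + b)) d, Lp.coeFn_smul (-2 : ℂ) (a + b), Lp.coeFn_add a b,
      Lp.coeFn_smul (2 * omega0 c k : ℂ) e,
      coeFn_mulOp h.isBddCont_principal.memLp_top v₂,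
      coeFn_mulOp h.isBddCont_deriv_principal.memLp_top v₁,
      coeFn_mulOp h.isBddCont_potential.memLp_top v, coeFn_helmholtzOp v]
      with x x1 x2 x3 x4 x5 x6 x7 x8 x9
    rw [x1, Pi.add_apply, x2, Pi.add_apply, x3, Pi.smul_apply, x4, Pi.add_apply, x5,
      Pi.smul_apply, x6, x7, x8, x9, hessianExpr]
    simp only [Complex.real_smul, smul_eq_mul]
    push_cast
    ring
  constructor
  · rintro ⟨w₁, w₂, h1', h2', h3⟩
    obtain rfl := h1.unique h1'
    obtain rfl := h2.unique h2'
    exact Lp.ext (h3.trans key.symm)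
  · rintro rfl
    exact ⟨v₁, v₂, h1, h2, key⟩

theorem inner_hessian (h : Profile c k φ φ' q) {v v₁ w w₁ f : L2} (hv : HasWeakDeriv v v₁)
    (hw : HasWeakDeriv w w₁) (hf : (w, f) ∈ hessianGraph c k φ) :
    inner ℂ v f = h.form v v₁ w w₁ := by
  obtain ⟨w₁', w₂, h1, h2, -⟩ := id hf
  obtain rfl := hw.unique h1
  rw [h.mem_hessianGraph_iff hw h2] at hf
  have hp := hv.inner_eq_neg (h2.mulOp h.contDiff_principal h.isBddCont_principal.memLp_top
    h.isBddCont_deriv_principal.memLp_top)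
  rw [hf, inner_add_right, inner_add_right, inner_smul_right, inner_smul_right, form, hp]
  ring

theorem isSymmetricOp (h : Profile c k φ φ' q) : IsSymmetricOp (hessian c k φ) := by
  intro x y
  have hx := mk_mem_hessianGraph x
  have hy := mk_mem_hessianGraph y
  obtain ⟨x₁, x₂, hx1, -⟩ := id hx
  obtain ⟨y₁, y₂, hy1, -⟩ := id hy
  rw [← inner_conj_symm, h.inner_hessian hy1 hx1 hx, h.inner_hessian hx1 hy1 hy, h.form_conj]

end Profile

theorem SpectralAssumption.hasSpectralGap {A : L2 →ₗ.[ℂ] L2} {lam δ : ℝ}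
    (h : ∀ z ∈ unboundedSpectrum A, z = (lam : ℂ) ∨ z = 0 ∨ ∃ r : ℝ, δ ≤ r ∧ z = (r : ℂ)) :
    HasSpectralGap A lam δ := by
  intro z h1 h2 h3
  by_contra hn
  rcases h z hn with h' | h' | ⟨r, hr, h'⟩
  · exact h1 h'
  · exact h2 h'
  · exact h3 r hr h'

namespace Profile

variable {c k : ℝ} {φ φ' q : ℝ → ℝ}

/-! ### The kernel of the Hessian -/

/-- The gradient of the constraint functional as an element of `L²`. -/
noncomputable def gradient (h : Profile c k φ φ' q) : L2 := ofRealLp _ h.memLp_constraintGradient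

/-- The translation mode `μ'` as an element of `L²`. -/
noncomputable def translationMode (h : Profile c k φ φ' q) : L2 :=
  ofRealLp _ h.memLp_deriv_momentum

theorem inner_translationMode_gradient (h : Profile c k φ φ' q) :
    inner ℂ h.translationMode h.gradient = 0 := by
  rw [translationMode, inner_ofRealLp]
  have e : ∫ x, (3 * paramA c k * (φ x * φ' x * q x ^ 5)) • h.gradient x =
      ((∫ x, constraintGradient k φ x * (3 * paramA c k * (φ x * φ' x * q x ^ 5)) : ℝ) : ℂ) := by
    rw [← integral_complex_ofReal]
    refine integral_congr_ae ?_
    filter_upwards [coeFn_ofRealLp h.memLp_constraintGradient] with x hx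
    rw [gradient, hx, Complex.real_smul]
    push_cast
    ring
  rw [e, h.integral_constraintGradient_mul_deriv_momentum, Complex.ofReal_zero]

theorem isPreimage_iff (h : Profile c k φ φ' q) (w : (hessian c k φ).domain) :
    IsPreimage c k φ w ↔ hessian c k φ w = h.gradient :=
  ⟨fun hw => Lp.ext (hw.trans (coeFn_ofRealLp _).symm), fun hw => by
    rw [IsPreimage, hw]; exact coeFn_ofRealLp _⟩

/-- Under the spectral assumption the kernel is spanned by the translation mode. -/
theorem exists_kernel (h : Profile c k φ φ' q) (h0 : IsSimpleEigenvalue (hessian c k φ) 0) :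
    ∃ χ : (hessian c k φ).domain, (χ : L2) = h.translationMode ∧ hessian c k φ χ = 0 ∧ χ ≠ 0 ∧
      ∀ v, hessian c k φ v = 0 → ∃ b : ℂ, v = b • χ := by
  obtain ⟨χ, hχ, hχ0⟩ := exists_domain_of_mem_hessianGraph h.deriv_momentum_mem_hessianGraph
  have hne : χ ≠ 0 := by
    rintro rfl
    exact h.deriv_momentum_ne_zero hχ.symm
  obtain ⟨ψ, -, -, hu⟩ := h0
  simp only [zero_smul] at hu
  obtain ⟨b, hb⟩ := hu χ hχ0
  have hb0 : b ≠ 0 := by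
    rintro rfl
    exact hne (by rw [hb, zero_smul])
  refine ⟨χ, hχ, hχ0, hne, fun v hv => ?_⟩
  obtain ⟨d, rfl⟩ := hu v hv
  exact ⟨d * b⁻¹, by rw [hb, smul_smul, inv_mul_cancel_right₀ hb0]⟩

/-! ### From the domain to `H¹` -/

/-- Coercivity passes from the domain of `𝓛` to `H¹`: approximate in `H¹` by elements of `H²` and
restore the two constraints by adding small multiples of `w` and of the translation mode. -/
theorem le_form_of_le_on_domain (h : Profile c k φ φ' q) {χ w : (hessian c k φ).domain}
    (hχn : χ ≠ 0) (hg : inner ℂ (hessian c k φ w) (χ : L2) = 0)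
    (hw : inner ℂ (hessian c k φ w) (w : L2) ≠ 0) {α : ℝ}
    (hα : ∀ v : (hessian c k φ).domain, inner ℂ (hessian c k φ w) (v : L2) = 0 →
      inner ℂ (χ : L2) (v : L2) = 0 →
      α * ‖(v : L2)‖ ^ 2 ≤ (inner ℂ (v : L2) (hessian c k φ v)).re)
    {v v₁ : L2} (hv : HasWeakDeriv v v₁) (hv1 : inner ℂ (hessian c k φ w) v = 0)
    (hv2 : inner ℂ (χ : L2) v = 0) : α * ‖v‖ ^ 2 ≤ (h.form v v₁ v v₁).re := by
  set g := hessian c k φ w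
  have hχ' : inner ℂ (χ : L2) (χ : L2) ≠ 0 := by
    rw [inner_self_ne_zero]
    exact fun h => hχn (Subtype.ext h)
  have hwg := mk_mem_hessianGraph w
  have hχg := mk_mem_hessianGraph χ
  obtain ⟨w₁, w₂, hw1, hw2, -⟩ := id hwg
  obtain ⟨χ₁, χ₂, hχ1, hχ2, -⟩ := id hχg
  -- the correction is continuous in the approximant and vanishes at `v`
  let s : L2 → ℂ := fun u => inner ℂ g u / inner ℂ g (w : L2)
  let t : L2 → ℂ := fun u => inner ℂ (χ : L2) (u - s u • (w : L2)) / inner ℂ (χ : L2) (χ : L2)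
  have cs : Continuous s := by fun_prop
  have ct : Continuous t := by fun_prop
  let Φ : L2 × L2 → L2 × L2 := fun p =>
    (p.1 - s p.1 • (w : L2) - t p.1 • (χ : L2), p.2 - s p.1 • w₁ - t p.1 • χ₁)
  have cΦ : Continuous Φ := by fun_prop
  have hs : s v = 0 := by simp only [s, hv1, zero_div]
  have ht : t v = 0 := by simp only [t, hs, zero_smul, sub_zero, hv2, zero_div]
  have hΦ : Φ (v, v₁) = (v, v₁) := by simp only [Φ, hs, ht, zero_smul, sub_zero]
  have approx : ∀ n : ℕ, ∃ u u₁ u₂ : L2, HasWeakDeriv u u₁ ∧ HasWeakDeriv u₁ u₂ ∧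
      ‖v - u‖ < 1 / ((n : ℝ) + 1) ∧ ‖v₁ - u₁‖ < 1 / ((n : ℝ) + 1) := fun n =>
    hv.exists_approx (by positivity)
  choose u u₁ u₂ hu hu' hd hd' using approx
  have tu : Tendsto u atTop (𝓝 v) := by
    rw [tendsto_iff_norm_sub_tendsto_zero]
    refine squeeze_zero (fun _ => norm_nonneg _) (fun n => ?_)
      (tendsto_one_div_add_atTop_nhds_zero_nat (𝕜 := ℝ))
    rw [norm_sub_rev]
    exact (hd n).le
  have tu' : Tendsto u₁ atTop (𝓝 v₁) := by
    rw [tendsto_iff_norm_sub_tendsto_zero]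
    refine squeeze_zero (fun _ => norm_nonneg _) (fun n => ?_)
      (tendsto_one_div_add_atTop_nhds_zero_nat (𝕜 := ℝ))
    rw [norm_sub_rev]
    exact (hd' n).le
  have tΦ : Tendsto (fun n => Φ (u n, u₁ n)) atTop (𝓝 (v, v₁)) := by
    have := (cΦ.tendsto (v, v₁)).comp (tu.prodMk_nhds tu')
    rwa [hΦ] at this
  have ineq : ∀ n, α * ‖(Φ (u n, u₁ n)).1‖ ^ 2 ≤
      (h.form (Φ (u n, u₁ n)).1 (Φ (u n, u₁ n)).2 (Φ (u n, u₁ n)).1 (Φ (u n, u₁ n)).2).re := by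
    intro n
    have d1 : HasWeakDeriv (Φ (u n, u₁ n)).1 (Φ (u n, u₁ n)).2 :=
      ((hu n).sub (hw1.smul _)).sub (hχ1.smul _)
    have d2 : HasWeakDeriv (Φ (u n, u₁ n)).2 (u₂ n - s (u n) • w₂ - t (u n) • χ₂) :=
      ((hu' n).sub (hw2.smul _)).sub (hχ2.smul _)
    have hmem := (h.mem_hessianGraph_iff d1 d2).2 rfl
    obtain ⟨y, hy, hAy⟩ := exists_domain_of_mem_hessianGraph hmem
    rw [← h.inner_hessian d1 d1 hmem, ← hAy, ← hy]
    refine hα y ?_ ?_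
    · rw [hy]
      simp only [Φ, inner_sub_right, inner_smul_right, hg, mul_zero, sub_zero, s]
      rw [div_mul_cancel₀ _ hw, sub_self]
    · rw [hy]
      simp only [Φ]
      rw [inner_sub_right, inner_smul_right, div_mul_cancel₀ _ hχ', sub_self]
  exact le_of_tendsto_of_tendsto' (((tΦ.fst_nhds.norm).pow 2).const_mul α)
    ((Complex.continuous_re.tendsto _).comp ((h.continuous_form.tendsto (v, v₁)).comp tΦ)) ineq

/-- The Gårding inequality for the form. -/
theorem exists_garding (h : Profile c k φ φ' q) : ∃ m C : ℝ, 0 < m ∧ 0 ≤ C ∧ ∀ v v₁ : L2,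
    m * ‖v₁‖ ^ 2 - C * ‖v‖ ^ 2 ≤ (h.form v v₁ v v₁).re := by
  obtain ⟨m, hm, hmp⟩ := h.exists_le_principal
  set MG := mulOp _ h.isBddCont_potential.memLp_top
  refine ⟨2 * m, ‖MG‖ + 2 * |omega0 c k| * ‖helmholtzOp‖, by positivity, by positivity,
    fun v v₁ => ?_⟩
  have b1 : m * ‖v₁‖ ^ 2 ≤ ∫ x, momentum φ x ^ (-8 / 3 : ℝ) * ‖v₁ x‖ ^ 2 := by
    rw [norm_sq_eq_integral, ← integral_const_mul]
    refine integral_mono ((integrable_norm_sq v₁).const_mul m)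
      (integrable_mul_norm_sq h.isBddCont_principal.memLp_top v₁) fun x => ?_
    exact mul_le_mul_of_nonneg_right (hmp x) (by positivity)
  have bound : ∀ T : L2 →L[ℂ] L2, |(inner ℂ v (T v)).re| ≤ ‖T‖ * ‖v‖ ^ 2 := by
    intro T
    calc |(inner ℂ v (T v)).re| ≤ ‖inner ℂ v (T v)‖ := Complex.abs_re_le_norm _
      _ ≤ ‖v‖ * ‖T v‖ := norm_inner_le_norm _ _
      _ ≤ ‖v‖ * (‖T‖ * ‖v‖) := by gcongr; exact T.le_opNorm v
      _ = ‖T‖ * ‖v‖ ^ 2 := by ring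
  have b2 := neg_le_of_abs_le (bound MG)
  have b3 : |2 * omega0 c k * (inner ℂ v (helmholtzOp v)).re| ≤
      2 * |omega0 c k| * (‖helmholtzOp‖ * ‖v‖ ^ 2) := by
    rw [abs_mul, abs_mul, abs_two]
    gcongr
    exact bound helmholtzOp
  have b3' := neg_le_of_abs_le b3
  have e3 : (2 * (omega0 c k : ℂ)) = ((2 * omega0 c k : ℝ) : ℂ) := by push_cast; rfl
  rw [form, inner_mulOp_self, e3, Complex.add_re, Complex.add_re, Complex.re_ofReal_mul]
  have e4 : (2 * ((∫ x, momentum φ x ^ (-8 / 3 : ℝ) * ‖v₁ x‖ ^ 2 : ℝ) : ℂ)).re =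
      2 * ∫ x, momentum φ x ^ (-8 / 3 : ℝ) * ‖v₁ x‖ ^ 2 := by simp
  rw [e4]
  linarith

theorem exists_preimage (h : Profile c k φ φ' q) (H : SpectralAssumption (hessian c k φ)) :
    ∃ w : (hessian c k φ).domain, IsPreimage c k φ w := by
  obtain ⟨lam, δ, hl, hδ, -, h0, hσ⟩ := H
  obtain ⟨χ, hχ, -, -, hu⟩ := h.exists_kernel h0
  obtain ⟨w, hw⟩ := (SpectralAssumption.hasSpectralGap hσ).exists_apply_eq hl hδ h.isSymmetricOp
    h.gradient (by
      intro x hx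
      obtain ⟨b, rfl⟩ := hu x hx
      rw [Submodule.coe_smul, inner_smul_left, hχ, h.inner_translationMode_gradient, mul_zero])
  exact ⟨w, (h.isPreimage_iff w).2 hw⟩

theorem isCoercive (h : Profile c k φ φ' q) (H : SpectralAssumption (hessian c k φ))
    (hVK : VakhitovKolokolov c k φ) : IsCoercive c k φ := by
  obtain ⟨lam, δ, hl, hδ, ⟨ψ, -, -, hψu⟩, h0, hσ⟩ := H
  obtain ⟨χ, hχ, hχ0, hχn, hu⟩ := h.exists_kernel h0
  obtain ⟨w, hw, hneg⟩ := hVK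
  rw [h.isPreimage_iff] at hw
  have pair : ∀ v : L2, inner ℂ h.gradient v = ∫ x, v x * (constraintGradient k φ x : ℂ) := by
    intro v
    rw [gradient, inner_ofRealLp]
    simp only [Complex.real_smul, mul_comm]
  have hneg' : (inner ℂ (w : L2) (hessian c k φ w)).re < 0 := by
    rw [hw, ← inner_conj_symm, Complex.conj_re, pair]
    exact hneg
  have hsym := h.isSymmetricOp
  obtain ⟨α, hα, hαv⟩ := (SpectralAssumption.hasSpectralGap hσ).exists_le_re_inner_of_orthogonal hl
    hδ hsym hψu hχ0 hχn hu hneg'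
  obtain ⟨m, C, hm, hC, hgard⟩ := h.exists_garding
  -- interpolate between coercivity in `L²` and the Gårding inequality
  set θ := α / (2 * (α + C)) with hθ
  have hθ0 : 0 < θ := by positivity
  have hθα : θ * (α + C) = α / 2 := by rw [hθ]; field_simp
  have hθ1 : θ ≤ 1 := by
    rw [hθ, div_le_one (by positivity)]; linarith
  refine ⟨min (α / 2) (θ * m), by positivity, fun v v₁ hv hv1 hv2 => ?_⟩
  have hlow : α * ‖v‖ ^ 2 ≤ (h.form v v₁ v v₁).re := by
    refine h.le_form_of_le_on_domain hχn ?_ ?_ hαv hv ?_ ?_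
    · rw [hsym, hχ0, inner_zero_right]
    · intro h'
      rw [hsym] at h'
      rw [h'] at hneg'
      simp at hneg'
    · rw [hw, pair, hv1]
    · rw [hχ, translationMode, inner_ofRealLp, ← hv2, h.deriv_momentum]
      simp only [Complex.real_smul, mul_comm]
  have hg := hgard v v₁
  rw [h.hessianForm_eq]
  set Q := (h.form v v₁ v v₁).re
  have hQ : Q = (1 - θ) * Q + θ * Q := by ring
  have k1 : (1 - θ) * (α * ‖v‖ ^ 2) ≤ (1 - θ) * Q :=
    mul_le_mul_of_nonneg_left hlow (by linarith)
  have k2 : θ * (m * ‖v₁‖ ^ 2 - C * ‖v‖ ^ 2) ≤ θ * Q := mul_le_mul_of_nonneg_left hg hθ0.le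
  have k3 : (1 - θ) * (α * ‖v‖ ^ 2) + θ * (m * ‖v₁‖ ^ 2 - C * ‖v‖ ^ 2) =
      α / 2 * ‖v‖ ^ 2 + θ * m * ‖v₁‖ ^ 2 := by
    linear_combination (-‖v‖ ^ 2) * hθα
  have k4 : min (α / 2) (θ * m) * ‖v‖ ^ 2 ≤ α / 2 * ‖v‖ ^ 2 := by
    gcongr; exact min_le_left _ _
  have k5 : min (α / 2) (θ * m) * ‖v₁‖ ^ 2 ≤ θ * m * ‖v₁‖ ^ 2 := by
    gcongr; exact min_le_right _ _
  rw [mul_add]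
  linarith

end Profile

end Novikov

theorem lemmaP (c k : ℝ) (hc : 0 < c) (hk : 0 < k) (hkc : k < √c / 2) (φ : ℝ → ℝ)
    (hφ : Novikov.IsSmoothSolitaryWave c k φ)
    (H1 : Novikov.SpectralAssumption (Novikov.hessian c k φ)) :
    (∃ w : (Novikov.hessian c k φ).domain, Novikov.IsPreimage c k φ w) ∧
      (Novikov.VakhitovKolokolov c k φ → Novikov.IsCoercive c k φ) := by
  have hck : 4 * k ^ 2 < c := by
    have h1 := Real.sq_sqrt hc.le
    nlinarith
  have h := hφ.exists_profile hk hck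
  exact ⟨h.exists_preimage H1, h.isCoercive H1⟩
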